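/- Fix a universal machine $U$, i.e. a partial computable function $U:\{0,1\}^*\rightharpoonup\{0,1\}^*$ such that for every partial computable $M$ there is a constant $c$ with $K_U(w)\le K_M(w)+c$ for all strings $w$, where $K_M(w)=\min\{|p| : M(p)=w\}$. Write $K=K_U$ (plain Kolmogorov complexity), and let $x(1:n)$ be the initial segment of length $n$ of $x\in\{0,1\}^\infty$. A sequence $x$ has randomness rate $\sigma$ if $K(x(1:n))\ge\sigma n$ for all but finitely many $n$. For $0<\alpha<1$, two sequences $x,y$ have dependency $n^\alpha$ if there is a constant $C$ (which may depend on $x,y$) such that for all integers $n,m\ge 1$ $$K(x(1:n))+K(y(1:m))-K(x(1:n)\,y(1:m))\le C\,(n^\alpha+m^\alpha).$$ A map $f:\{0,1\}^\infty\times\{0,1\}^\infty\to\{0,1\}^\infty$ is a truth-table reduction if some two-oracle machine, halting on all inputs and with all oracles, outputs the $n$-th bit of $f(x,y)$ on input $n$ with oracles $x,y$. A map $F:\mathbb{Q}\times\{0,1\}^\infty\times\{0,1\}^\infty\to\{0,1\}^\infty$ is a uniform truth-table reduction if one single two-oracle machine, halting on all inputs and with all oracles, outputs the $n$-th bit of $F(q,x,y)$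 on input $(q,n)$ with oracles $x,y$. Theorem. For every real $\tau>0$ there exist $\alpha\in(0,1)$ and a truth-table reduction $f$ such that, for all $x,y\in\{0,1\}^\infty$ which have dependency $n^\alpha$ and both have randomness rate $\tau$, the sequence $f(x,y)$ has randomness rate $1-\delta$ for every $\delta>0$. Moreover, $f$ is uniform in $\tau$: there is a uniform truth-table reduction $F$ such that for every rational $\tau>0$ there is $\alpha\in(0,1)$ for which $f=F(\tau,\cdot,\cdot)$ has this property. -/

import Mathlib

/-- Infinite binary sequences; `x i` is the `(i+1)`-st bit of `x`. -/
abbrev BinSeq : Type := ℕ → Bool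

/-- The initial segment `x(1:n)`, a string of length `n`. -/
def initSeg (x : BinSeq) (n : ℕ) : List Bool := (List.range n).map x

/-! ### Plain Kolmogorov complexity -/

/-- `K_M(w) = min {|p| : M(p) = w}`, with value `⊤` if no program `p` produces `w`. -/
noncomputable def complexityOf (M : List Bool →. List Bool) (w : List Bool) : ℕ∞ :=
  ⨅ (p : List Bool) (_ : w ∈ M p), (p.length : ℕ∞)

/-- `U` is a universal machine for plain Kolmogorov complexity: a partial computable function on
binary strings such that `K_U ≤ K_M + O(1)` for every partial computable `M`. -/
structure IsUniversalMachine (U : List Bool →. List Bool) : Prop where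
  partrec : Partrec U
  optimal : ∀ M : List Bool →. List Bool, Partrec M →
    ∃ c : ℕ, ∀ w : List Bool, complexityOf U w ≤ complexityOf M w + c

/-- With respect to a universal machine every string has finite complexity. -/
theorem IsUniversalMachine.complexityOf_ne_top {U : List Bool →. List Bool}
    (hU : IsUniversalMachine U) (w : List Bool) : complexityOf U w ≠ ⊤ := by
  obtain ⟨c, hc⟩ := hU.optimal (fun p => Part.some p) Partrec.some
  have h1 : complexityOf (fun p => Part.some p) w ≤ (w.length : ℕ∞) :=
    iInf₂_le (f := fun (p : List Bool) (_ : w ∈ Part.some p) => (p.length : ℕ∞)) w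
      (Part.mem_some w)
  have h2 : complexityOf U w ≤ ((w.length + c : ℕ) : ℕ∞) := by
    refine (hc w).trans ?_
    push_cast
    gcongr
  exact ne_top_of_le_ne_top (ENat.natCast_ne_top _) h2

/-- The plain Kolmogorov complexity `K(w)` as a natural number (for universal `U` the value
`complexityOf U w` is finite, so nothing is lost). -/
noncomputable def plainK (U : List Bool →. List Bool) (w : List Bool) : ℕ :=
  (complexityOf U w).toNat

/-- `x` has randomness rate `σ`: `K(x(1:n)) ≥ σ n` for all but finitely many `n`. -/
def HasRandomnessRate (U : List Bool →. List Bool) (σ : ℝ) (x : BinSeq) : Prop :=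
  ∀ᶠ n : ℕ in Filter.atTop, σ * (n : ℝ) ≤ (plainK U (initSeg x n) : ℝ)

/-- `x` and `y` have dependency `g`: for all positive integers `n, m`,
`K(x(1:n)) + K(y(1:m)) - K(x(1:n) y(1:m)) ≤ O(g n + g m)`. -/
def HasDependency (U : List Bool →. List Bool) (g : ℕ → ℝ) (x y : BinSeq) : Prop :=
  ∃ C : ℝ, ∀ n m : ℕ, 1 ≤ n → 1 ≤ m →
    (plainK U (initSeg x n) : ℝ) + (plainK U (initSeg y m) : ℝ)
      - (plainK U (initSeg x n ++ initSeg y m) : ℝ) ≤ C * (g n + g m)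

/-! ### Machines with two oracles -/

/-- Programs of machines that have access to two oracles: the codes of partial recursive functions
(zero, successor, projections, pairing, composition, primitive recursion, unbounded search),
together with one query instruction for each oracle. -/
inductive OracleCode : Type
  | zero : OracleCode
  | succ : OracleCode
  | left : OracleCode
  | right : OracleCode
  | query₁ : OracleCode
  | query₂ : OracleCode
  | pair : OracleCode → OracleCode → OracleCode
  | comp : OracleCode → OracleCode → OracleCode
  | prec : OracleCode → OracleCode → OracleCode
  | rfind : OracleCode → OracleCode

/-- The partial function `ℕ →. ℕ` computed by a program working with the oracles `x` and `y`;
the answer to a query is the queried bit, as `0` or `1`. -/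
def OracleCode.eval (x y : BinSeq) : OracleCode → ℕ →. ℕ
  | .zero => fun _ => Part.some 0
  | .succ => fun n => Part.some (n + 1)
  | .left => fun n => Part.some n.unpair.1
  | .right => fun n => Part.some n.unpair.2
  | .query₁ => fun n => Part.some (x n).toNat
  | .query₂ => fun n => Part.some (y n).toNat
  | .pair f h => fun n => (eval x y f n).bind fun a => (eval x y h n).map fun b => Nat.pair a b
  | .comp f h => fun n => (eval x y h n).bind (eval x y f)
  | .prec f h => fun p =>
      Nat.rec (eval x y f p.unpair.1)
        (fun k IH => IH.bind fun i => eval x y h (Nat.pair p.unpair.1 (Nat.pair k i))) p.unpair.2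
  | .rfind f => fun a => Nat.rfind fun n => (eval x y f (Nat.pair a n)).map fun m => decide (m = 0)

/-- A canonical representation of rational numbers by natural numbers: the pair of the numerator
(with `k ≥ 0` coded as `2k` and `-(k+1)` as `2k+1`) and the denominator, in lowest terms. -/
def ratCode (q : ℚ) : ℕ := Nat.pair (Equiv.intEquivNat q.num) q.den

/-- `f` is a truth-table reduction: some two-oracle machine which halts on all inputs and with all
oracles outputs, on input `n` and with oracles `x`, `y`, the bit of `f x y` at position `n`. -/
def IsTruthTableReduction (f : BinSeq → BinSeq → BinSeq) : Prop :=
  ∃ M : OracleCode, ∀ (x y : BinSeq) (n : ℕ),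
    M.eval x y n = Part.some (f x y n).toNat

/-- `F` is a truth-table reduction that is uniform in its rational parameter: some single two-oracle
machine which halts on all inputs and with all oracles outputs, on input `(q, n)` and with oracles
`x`, `y`, the bit of `F q x y` at position `n`. -/
def IsUniformTruthTableReduction (F : ℚ → BinSeq → BinSeq → BinSeq) : Prop :=
  ∃ M : OracleCode, ∀ (q : ℚ) (x y : BinSeq) (n : ℕ),
    M.eval x y (Nat.pair (ratCode q) n) = Part.some (F q x y n).toNat

/-- For all sequences `x`, `y` with dependency `n ^ α` and randomness rate `τ`, the sequence `f x y`
has randomness rate `1 - δ` for every `δ > 0`. -/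
def ExtractsRandomness (U : List Bool →. List Bool) (τ α : ℝ)
    (f : BinSeq → BinSeq → BinSeq) : Prop :=
  ∀ x y : BinSeq, HasDependency U (fun n => (n : ℝ) ^ α) x y →
    HasRandomnessRate U τ x → HasRandomnessRate U τ y →
      ∀ δ : ℝ, 0 < δ → HasRandomnessRate U (1 - δ) (f x y)

/-! A random table is balanced: for B ≥ 2 some table with 2^(B^4) rows and columns and B^2-bit
entries has no value more than 8·2^(3B^2) times in any rectangle with sides at most 2^(2B^2), which
up to the factor 8 is the average for the largest such rectangle (`exists_balanced_function`). It is
found by bounded search, so reading the bits in [B, B^2), for B = 2^(2^i), off the entry in row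
x(1:B^4) and column y(1:B^4) is a truth-table reduction. Neither this map nor the exponent α = 1/8
depends on τ, which makes uniformity free; τ only decides how soon the estimates apply.

Let b = 2^(2^j) and b^2 ≤ n ≤ b^4. Let w be the first n extracted bits, u = x(1:b^8), v = y(1:b^8),
and p, q the prefixes of u, v of length b^4. The first b bits of w are given up; those in [b, b^2)
depend on (p, q), those in [b^2, n) on (u, v). By balance, at most about 2^(b + K(p) + K(q) - b^2)
pairs of strings of complexity at most K(p), K(q) yield the former bits, and for fixed prefixes at
most about 2^(b^2 + m₁ + m₂ - n) pairs from lists of 2^m₁ and 2^m₂ extensions yield the latter. In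
the product b^2 cancels (`exists_finset_isDescribedPair`), so w and an index describe uv
(`exists_plainK_append_le`): K(uv) ≤ K(w) + b + K(p) + K(q) + m₁ + m₂ - n + O(log b).

Symmetry of information (`exists_mem_take_extensionEnum`) allows K(p) + m₁ ≤ K(u) + O(log b), and
likewise for v. The dependency gives K(uv) ≥ K(u) + K(v) - 2|C|b, since (b^8)^(1/8) = b. Hence K(w)
≥ n - O(b) with b ≤ √n. Two consecutive blocks are treated together because for n barely above b^2,
giving up everything before the current block would cost nearly all of w. -/

open Nat.Partrec (Code)
open Encodable

/-! ### Enumerations without repetitions -/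

section Enumeration

variable {α β : Type*}

/-- The distinct elements among the first `k` values of `e`, in order of appearance. -/
def enumList [DecidableEq β] (e : ℕ → Option β) : ℕ → List β
  | 0 => []
  | k + 1 => match e k with
    | none => enumList e k
    | some b => if (enumList e k).idxOf b < (enumList e k).length then enumList e k
        else enumList e k ++ [b]

/-- An enumerator for the projection of a primitive recursive relation. -/
def enumOfRel [Encodable β] (R : β → ℕ → Prop) [∀ b, DecidablePred (R b)] (k : ℕ) : Option β :=
  (decode k.unpair.1 : Option β).bind fun b => if R b k.unpair.2 then some b else none

theorem exists_enumOfRel [Encodable β] {R : β → ℕ → Prop} [∀ b, DecidablePred (R b)] {b : β} :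
    (∃ k, enumOfRel R k = some b) ↔ ∃ k, R b k := by
  constructor
  · rintro ⟨k, hk⟩
    simp only [enumOfRel, Option.bind_eq_some_iff] at hk
    obtain ⟨b', -, h⟩ := hk
    split_ifs at h with h'
    exact ⟨_, Option.some.inj h ▸ h'⟩
  · rintro ⟨k, hk⟩
    exact ⟨Nat.pair (encode b) k, by simp [enumOfRel, hk]⟩

theorem primrec_enumOfRel [Primcodable α] [Primcodable β] {R : α → β → ℕ → Prop}
    [∀ a b, DecidablePred (R a b)]
    (hR : PrimrecPred fun q : (α × β) × ℕ => R q.1.1 q.1.2 q.2) :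
    Primrec₂ fun a k => enumOfRel (R a) k := by
  have hu : Primrec fun q : α × ℕ => q.2.unpair := Primrec.unpair.comp Primrec.snd
  refine Primrec.option_bind (Primrec.decode.comp (Primrec.fst.comp hu)) ?_
  refine Primrec.ite (hR.comp (Primrec.pair (Primrec.pair
    (Primrec.fst.comp Primrec.fst) Primrec.snd) (Primrec.snd.comp (hu.comp Primrec.fst))))
    (Primrec.option_some.comp Primrec.snd) (Primrec.const _)

variable [DecidableEq β]

theorem enumList_prefix_succ (e : ℕ → Option β) (k : ℕ) :
    enumList e k <+: enumList e (k + 1) := by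
  rw [enumList]
  split
  · exact List.prefix_rfl
  · split_ifs
    · exact List.prefix_rfl
    · exact List.prefix_append _ _

theorem enumList_prefix (e : ℕ → Option β) {k l : ℕ} (h : k ≤ l) :
    enumList e k <+: enumList e l := by
  induction l, h using Nat.le_induction with
  | base => exact List.prefix_rfl
  | succ l _ ih => exact ih.trans (enumList_prefix_succ e l)

theorem nodup_enumList (e : ℕ → Option β) (k : ℕ) : (enumList e k).Nodup := by
  induction k with
  | zero => exact List.nodup_nil
  | succ k ih =>
    rw [enumList]
    split
    · exact ih
    · rename_i b _
      split_ifs with h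
      · exact ih
      · rw [List.idxOf_lt_length_iff] at h
        exact List.nodup_append.2 ⟨ih, by simp, by
          rintro a ha c hc rfl; simp at hc; exact h (hc ▸ ha)⟩

theorem mem_enumList {e : ℕ → Option β} {k : ℕ} {b : β} :
    b ∈ enumList e k ↔ ∃ l < k, e l = some b := by
  induction k with
  | zero => simp [enumList]
  | succ k ih =>
    rw [enumList]
    have key : (∃ l < k + 1, e l = some b) ↔ b ∈ enumList e k ∨ e k = some b := by
      rw [ih]
      constructor
      · rintro ⟨l, hl, h⟩
        rcases Nat.lt_succ_iff_lt_or_eq.1 hl with h' | rfl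
        · exact Or.inl ⟨l, h', h⟩
        · exact Or.inr h
      · rintro (⟨l, hl, h⟩ | h)
        · exact ⟨l, by omega, h⟩
        · exact ⟨k, by omega, h⟩
    rw [key]
    split
    · simp_all
    · rename_i c hc
      rw [hc]
      split_ifs with h
      · rw [List.idxOf_lt_length_iff] at h
        constructor
        · exact Or.inl
        · rintro (h' | h')
          · exact h'
          · exact (Option.some.inj h') ▸ h
      · simp [eq_comm]

theorem length_enumList_le {e : ℕ → Option β} {S : Set β} {n : ℕ} (hS : S.encard ≤ n)
    (h : ∀ k b, e k = some b → b ∈ S) (k : ℕ) : (enumList e k).length ≤ n := by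
  have h1 : ((enumList e k).toFinset : Set β) ⊆ S := by
    intro b hb
    simp only [List.coe_toFinset, Set.mem_ofPred_eq] at hb
    obtain ⟨l, -, hl⟩ := mem_enumList.1 hb
    exact h l b hl
  have h2 := (Set.encard_le_encard h1).trans hS
  rw [Set.encard_coe_eq_coe_finsetCard, List.toFinset_card_of_nodup (nodup_enumList e k)] at h2
  exact_mod_cast h2

theorem enumList_getElem?_mono {e : ℕ → Option β} {k l j : ℕ} {b : β} (h : k ≤ l)
    (hb : (enumList e k)[j]? = some b) : (enumList e l)[j]? = some b := by
  obtain ⟨r, hr⟩ := enumList_prefix e h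
  rw [← hr, List.getElem?_append_left, hb]
  exact (List.getElem?_eq_some_iff.1 hb).1

theorem primrec_enumList [Primcodable α] [Primcodable β] {e : α → ℕ → Option β}
    (he : Primrec₂ e) : Primrec₂ fun a k => enumList (e a) k := by
  have hg : Primrec₂ fun (q : α × ℕ) (r : ℕ × List β) =>
      (Option.casesOn (e q.1 r.1) r.2 fun b =>
        if r.2.idxOf b < r.2.length then r.2 else r.2 ++ [b] : List β) := by
    refine Primrec.option_casesOn
      (he.comp (Primrec.fst.comp Primrec.fst) (Primrec.fst.comp Primrec.snd))
      (Primrec.snd.comp Primrec.snd) ?_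
    have hl : Primrec fun x : ((α × ℕ) × ℕ × List β) × β => x.1.2.2 :=
      Primrec.snd.comp (Primrec.snd.comp Primrec.fst)
    exact Primrec.ite
      (Primrec.nat_lt.comp (Primrec.list_idxOf.comp Primrec.snd hl) (Primrec.list_length.comp hl))
      hl (Primrec.list_concat.comp hl Primrec.snd)
  refine (Primrec.nat_rec' (f := fun q : α × ℕ => q.2) (g := fun _ => ([] : List β))
    Primrec.snd (Primrec.const _) hg).of_eq fun q => ?_
  obtain ⟨a, k⟩ := q
  induction k with
  | zero => rfl
  | succ k ih =>
    change _ = enumList (e a) (k + 1)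
    simp only at ih ⊢
    rw [enumList, ← ih]
    cases h : e a k <;> simp

/-- The element number `j` in the enumeration of the values of `e`. -/
def enumGet (e : ℕ → Option β) (j : ℕ) : Part β :=
  Nat.rfindOpt fun k => (enumList e k)[j]?

/-- Earlier lists are prefixes of later ones, so the entry at a fixed position never changes once it
has appeared. -/
theorem mem_enumGet {e : ℕ → Option β} {j : ℕ} {b : β} :
    b ∈ enumGet e j ↔ ∃ k, (enumList e k)[j]? = some b :=
  Nat.rfindOpt_mono fun hmn => enumList_getElem?_mono hmn

end Enumeration

/-! ### Strings and numbers -/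

/-- The number with binary digits `l`, least significant digit first. -/
def bitsToNat (l : List Bool) : ℕ := l.foldr (fun b s => b.toNat + 2 * s) 0

@[simp] theorem bitsToNat_nil : bitsToNat [] = 0 := rfl

@[simp] theorem bitsToNat_cons (b : Bool) (l : List Bool) :
    bitsToNat (b :: l) = b.toNat + 2 * bitsToNat l := rfl

theorem bitsToNat_lt (l : List Bool) : bitsToNat l < 2 ^ l.length := by
  induction l with
  | nil => simp
  | cons b l ih => cases b <;> simp [pow_succ] <;> omega

theorem bitsToNat_concat (l : List Bool) (b : Bool) :
    bitsToNat (l ++ [b]) = bitsToNat l + b.toNat * 2 ^ l.length := by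
  induction l with
  | nil => simp
  | cons c l ih => simp only [List.cons_append, bitsToNat_cons, ih, List.length_cons]; ring

theorem bitsToNat_inj {l₁ l₂ : List Bool} (hl : l₁.length = l₂.length)
    (h : bitsToNat l₁ = bitsToNat l₂) : l₁ = l₂ := by
  induction l₁ generalizing l₂ with
  | nil => simpa [eq_comm] using hl
  | cons b l ih =>
    cases l₂ with
    | nil => simp at hl
    | cons c l' =>
      simp only [bitsToNat_cons] at h
      have h1 : b = c := by cases b <;> cases c <;> simp at h ⊢ <;> omega
      subst h1
      rw [ih (by simpa using hl) (by omega)]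

/-- The `a` least significant binary digits of `n`. -/
def natToBits (a n : ℕ) : List Bool := (List.range a).map n.testBit

@[simp] theorem length_natToBits (a n : ℕ) : (natToBits a n).length = a := by simp [natToBits]

theorem natToBits_succ (a n : ℕ) : natToBits (a + 1) n = n.testBit 0 :: natToBits a (n / 2) := by
  rw [natToBits, List.range_succ_eq_map, List.map_cons, List.map_map, natToBits]
  congr 1
  refine List.map_congr_left fun i _ => ?_
  simp [Nat.testBit_succ]

theorem bitsToNat_natToBits {a n : ℕ} (h : n < 2 ^ a) : bitsToNat (natToBits a n) = n := by
  induction a generalizing n with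
  | zero => simp at h; simp [natToBits, h]
  | succ a ih =>
    rw [natToBits_succ, bitsToNat_cons, ih (by rw [pow_succ] at h; omega)]
    rw [Nat.testBit_zero]
    rcases Nat.mod_two_eq_zero_or_one n with h | h <;> simp [h] <;> omega

theorem primrec_bitsToNat : Primrec bitsToNat :=
  Primrec.list_foldr Primrec.id (Primrec.const 0)
    (Primrec.nat_add.comp ((Primrec.dom_bool Bool.toNat).comp (Primrec.fst.comp Primrec.snd))
      (Primrec.nat_mul.comp (Primrec.const 2) (Primrec.snd.comp Primrec.snd))).to₂

/-- A top digit 1 makes the numerical value remember the length, which embeds these strings into the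
numbers below 2^(k+1). -/
theorem encard_length_le (k : ℕ) : {l : List Bool | l.length ≤ k}.encard ≤ (2 ^ (k + 1) : ℕ) := by
  have h1 : Set.InjOn (fun l : List Bool => bitsToNat (l ++ [true])) {l | l.length ≤ k} := by
    intro l _ l' _ h
    simp only [bitsToNat_concat, Bool.toNat_true, one_mul] at h
    have hlt := bitsToNat_lt l
    have hlt' := bitsToNat_lt l'
    have hl : l.length = l'.length := by
      rcases lt_trichotomy l.length l'.length with h2 | h2 | h2
      · have := Nat.pow_le_pow_right (show 0 < 2 by simp) (Nat.succ_le_of_lt h2)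
        rw [Nat.succ_eq_add_one, pow_succ] at this
        omega
      · exact h2
      · have := Nat.pow_le_pow_right (show 0 < 2 by simp) (Nat.succ_le_of_lt h2)
        rw [Nat.succ_eq_add_one, pow_succ] at this
        omega
    rw [hl] at h
    exact bitsToNat_inj hl (by omega)
  have h2 : Set.MapsTo (fun l : List Bool => bitsToNat (l ++ [true])) {l | l.length ≤ k}
      (Finset.range (2 ^ (k + 1)) : Finset ℕ) := by
    intro l hl
    simp only [Set.mem_ofPred_eq] at hl
    simp only [Finset.coe_range, Set.mem_Iio]
    refine (bitsToNat_lt _).trans_le (Nat.pow_le_pow_right (by simp) ?_)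
    simpa using hl
  refine (Set.encard_le_encard_of_injOn h2 h1).trans ?_
  rw [Set.encard_coe_eq_coe_finsetCard, Finset.card_range]

/-! ### Descriptions by position in an enumeration -/

theorem natPair_lt_two_pow {a b n : ℕ} (ha : a < 2 ^ n) (hb : b < 2 ^ n) :
    Nat.pair a b < 2 ^ (2 * n) := by
  refine (Nat.pair_lt_max_add_one_sq a b).trans_le ?_
  rw [pow_mul']
  exact Nat.pow_le_pow_left (max_lt ha hb) 2

theorem complexityOf_le {M : List Bool →. List Bool} {p w : List Bool} (h : w ∈ M p) :
    complexityOf M w ≤ (p.length : ℕ∞) :=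
  iInf₂_le (f := fun (p : List Bool) (_ : w ∈ M p) => (p.length : ℕ∞)) p h

namespace IsUniversalMachine

variable {U : List Bool →. List Bool} (hU : IsUniversalMachine U)
include hU

theorem coe_plainK (w : List Bool) : (plainK U w : ℕ∞) = complexityOf U w :=
  ENat.natCast_toNat (hU.complexityOf_ne_top w)

theorem exists_program (w : List Bool) : ∃ p, w ∈ U p ∧ p.length = plainK U w := by
  by_contra! h
  have h1 : ((plainK U w + 1 : ℕ) : ℕ∞) ≤ complexityOf U w := by
    refine le_iInf₂ fun p hp => ?_
    have h2 : (plainK U w : ℕ∞) ≤ p.length := by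
      rw [hU.coe_plainK]; exact complexityOf_le hp
    have h3 : plainK U w ≤ p.length := by exact_mod_cast h2
    exact_mod_cast lt_of_le_of_ne h3 (Ne.symm (h p hp))
  rw [← hU.coe_plainK] at h1
  have : plainK U w + 1 ≤ plainK U w := by exact_mod_cast h1
  omega

theorem plainK_le_length {p w : List Bool} (h : w ∈ U p) : plainK U w ≤ p.length := by
  have := complexityOf_le h
  rw [← hU.coe_plainK] at this
  exact_mod_cast this

theorem exists_plainK_le {M : List Bool →. List Bool} (hM : Partrec M) :
    ∃ c, ∀ p w, w ∈ M p → plainK U w ≤ p.length + c := by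
  obtain ⟨c, hc⟩ := hU.optimal M hM
  refine ⟨c, fun p w h => ?_⟩
  have := (hc w).trans (add_le_add_left (complexityOf_le h) (c : ℕ∞))
  rw [← hU.coe_plainK] at this
  exact_mod_cast this

theorem exists_plainK_le_length : ∃ c, ∀ w, plainK U w ≤ w.length + c := by
  obtain ⟨c, hc⟩ := hU.exists_plainK_le (M := fun p => Part.some p) Partrec.some
  exact ⟨c, fun w => hc w w (Part.mem_some w)⟩

/-- A string which occurs in an enumeration of at most `2 ^ s` strings, computed from a number `c`
and a string `w`, has a description by `w`, its position in the enumeration, `c` and `s`. -/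
theorem exists_plainK_le_of_enum {e : ℕ × List Bool → ℕ → Option (List Bool)} (he : Primrec₂ e) :
    ∃ D, ∀ c w s a u, c < 2 ^ a → s < 2 ^ a → (∃ k, e (c, w) k = some u) →
      (∀ k, (enumList (e (c, w)) k).length ≤ 2 ^ s) →
      plainK U u ≤ plainK U w + s + 4 * a + D := by
  -- Layout of a program: 2a in unary, ended by `false`; 2a digits for the pair (c, s); s digits for
  -- the position; a shortest program for w. The last part needs no delimiter, and the overhead is
  -- 4a + 1.
  let hdr : List Bool → ℕ := fun p => p.idxOf false
  let num : List Bool → ℕ := fun p => bitsToNat ((p.drop (hdr p + 1)).take (hdr p))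
  let rst : List Bool → List Bool := fun p => (p.drop (hdr p + 1)).drop (hdr p)
  let cc : List Bool → ℕ := fun p => (num p).unpair.1
  let ss : List Bool → ℕ := fun p => (num p).unpair.2
  let M : List Bool →. List Bool := fun p =>
    (U ((rst p).drop (ss p))).bind fun w => enumGet (e (cc p, w)) (bitsToNat ((rst p).take (ss p)))
  have hhdr : Primrec hdr := Primrec.list_idxOf.comp (Primrec.const false) Primrec.id
  have hd : Primrec fun p : List Bool => p.drop (hdr p + 1) :=
    Primrec.list_drop.comp (Primrec.succ.comp hhdr) Primrec.id
  have hnum : Primrec num := primrec_bitsToNat.comp (Primrec.list_take.comp hhdr hd)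
  have hrst : Primrec rst := Primrec.list_drop.comp hhdr hd
  have hcc : Primrec cc := Primrec.fst.comp (Primrec.unpair.comp hnum)
  have hss : Primrec ss := Primrec.snd.comp (Primrec.unpair.comp hnum)
  have hM : Partrec M := by
    refine Partrec.bind (hU.partrec.comp (Primrec.list_drop.comp hss hrst).to_comp) ?_
    refine Partrec.rfindOpt (Primrec.to_comp ?_)
    have h1 : Primrec fun q : (List Bool × List Bool) × ℕ => q.1.1 := Primrec.fst.comp Primrec.fst
    refine Primrec.list_getElem?.comp ((primrec_enumList he).comp (Primrec.pair
      (hcc.comp h1) (Primrec.snd.comp Primrec.fst)) Primrec.snd) ?_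
    exact primrec_bitsToNat.comp (Primrec.list_take.comp (hss.comp h1) (hrst.comp h1))
  obtain ⟨D, hD⟩ := hU.exists_plainK_le hM
  refine ⟨D + 1, fun c w s a u hc hs hu hlen => ?_⟩
  obtain ⟨q, hq, hql⟩ := hU.exists_program w
  obtain ⟨k, hk⟩ := hu
  have hmem : u ∈ enumList (e (c, w)) (k + 1) := mem_enumList.2 ⟨k, by omega, hk⟩
  obtain ⟨j, hj, hju⟩ := List.getElem_of_mem hmem
  have hpair : Nat.pair c s < 2 ^ (2 * a) := natPair_lt_two_pow hc hs
  let p : List Bool := List.replicate (2 * a) true ++ (false ::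
    (natToBits (2 * a) (Nat.pair c s) ++ (natToBits s j ++ q)))
  have e1 : hdr p = 2 * a := by
    simp only [hdr, p]
    rw [List.idxOf_append_of_notMem (by simp)]
    simp
  have e2 : p.drop (2 * a + 1) = natToBits (2 * a) (Nat.pair c s) ++ (natToBits s j ++ q) := by
    simp only [p]
    rw [← List.drop_drop, List.drop_left' (by simp), List.drop_one, List.tail_cons]
  have e3 : num p = Nat.pair c s := by
    simp only [num, e1, e2]
    rw [List.take_left' (by simp), bitsToNat_natToBits hpair]
  have e4 : rst p = natToBits s j ++ q := by
    simp only [rst, e1, e2]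
    rw [List.drop_left' (by simp)]
  have hp : u ∈ M p := by
    simp only [M, cc, ss, e3, e4, Nat.unpair_pair]
    rw [List.drop_left' (by simp), List.take_left' (by simp)]
    refine Part.mem_bind hq (mem_enumGet.2 ⟨k + 1, ?_⟩)
    rw [bitsToNat_natToBits (hj.trans_le (hlen _)), List.getElem?_eq_getElem hj, hju]
  have := hD p u hp
  simp only [p, List.length_append, List.length_replicate, List.length_cons,
    length_natToBits] at this
  omega

end IsUniversalMachine

/-! ### Balanced tables -/

section Existence

open Finset

/-- Exponential moment of a count: the weight is a product over cells, so the sum factors. A cell of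
S contributes M - 1 values of weight 1 and one of weight 2. -/
theorem sum_two_pow_card_filter {κ : Type*} [Fintype κ] [DecidableEq κ] {M : ℕ} (S : Finset κ)
    (z : Fin M) :
    ∑ F : κ → Fin M, 2 ^ #{k ∈ S | F k = z} =
      (M + 1) ^ #S * M ^ (Fintype.card κ - #S) := by
  have h1 : ∀ F : κ → Fin M, 2 ^ #{k ∈ S | F k = z} =
      ∏ k, if k ∈ S ∧ F k = z then 2 else 1 := by
    intro F
    rw [Finset.prod_ite, Finset.prod_const_one, mul_one, Finset.prod_const]
    congr 2
    ext k
    simp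
  have hM : 0 < M := z.pos
  have h2 : ∀ k : κ, (∑ a : Fin M, if k ∈ S ∧ a = z then 2 else 1) =
      if k ∈ S then M + 1 else M := by
    intro k
    by_cases hk : k ∈ S
    · simp only [hk, true_and, if_true]
      rw [Finset.sum_ite, Finset.sum_const, Finset.sum_const, Finset.filter_eq',
        Finset.filter_ne', if_pos (mem_univ _), card_singleton, card_erase_of_mem (mem_univ _)]
      simp
      omega
    · simp [hk]
  simp_rw [h1]
  rw [← Fintype.piFinset_univ, ← Finset.prod_univ_sum (fun _ => univ)
    (fun k a => if k ∈ S ∧ a = z then 2 else 1)]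
  simp_rw [h2]
  rw [Finset.prod_ite, Finset.prod_const, Finset.prod_const, Finset.filter_mem_eq_inter,
    Finset.univ_inter]
  congr 2
  rw [← Finset.card_univ, ← Finset.card_sdiff_of_subset (subset_univ S)]
  congr 1
  ext k
  simp

/-- Chernoff bound in counting form: the mean of 2^count is at most (1 + 1/M)^#S ≤ e^E ≤ 2^(2E), so
by Markov a count above 8E has probability at most 2^(-6E). -/
theorem card_heavy_functions_le {κ : Type*} [Fintype κ] [DecidableEq κ] {M E : ℕ} (S : Finset κ)
    (hS : #S ≤ M * E) (z : Fin M) :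
    #{F : κ → Fin M | 8 * E < #{k ∈ S | F k = z}} * 2 ^ (6 * E) ≤ M ^ Fintype.card κ := by
  have hM : 0 < M := z.pos
  have h1 : #{F : κ → Fin M | 8 * E < #{k ∈ S | F k = z}} * 2 ^ (8 * E) ≤
      (M + 1) ^ #S * M ^ (Fintype.card κ - #S) := by
    rw [← sum_two_pow_card_filter S z, ← smul_eq_mul]
    refine (Finset.card_nsmul_le_sum _ _ _ fun F hF => ?_).trans
      (Finset.sum_le_sum_of_subset (Finset.subset_univ _))
    exact Nat.pow_le_pow_right (by simp) (Finset.mem_filter.1 hF).2.le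
  have h2 : (M + 1) ^ #S * M ^ (Fintype.card κ - #S) ≤ M ^ Fintype.card κ * 2 ^ (2 * E) := by
    have h3 : ((M : ℝ) + 1) ^ #S ≤ M ^ #S * 2 ^ (2 * E) := by
      have h4 : ((M : ℝ) + 1) = M * (1 + 1 / M) := by field_simp
      rw [h4, mul_pow]
      gcongr
      calc (1 + 1 / (M : ℝ)) ^ #S ≤ (Real.exp (1 / M)) ^ #S := by
            gcongr
            linarith [Real.add_one_le_exp (1 / (M : ℝ))]
        _ = Real.exp (#S / M) := by rw [← Real.exp_nat_mul]; ring_nf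
        _ ≤ Real.exp E := by
            gcongr
            rw [div_le_iff₀ (by positivity), mul_comm]
            exact_mod_cast hS
        _ = Real.exp 1 ^ E := by rw [← Real.exp_nat_mul, mul_one]
        _ ≤ 4 ^ E := by
            gcongr
            linarith [Real.exp_one_lt_three]
        _ = 2 ^ (2 * E) := by rw [pow_mul]; norm_num
    have h5 : (M + 1) ^ #S ≤ M ^ #S * 2 ^ (2 * E) := by exact_mod_cast h3
    calc _ ≤ (M ^ #S * 2 ^ (2 * E)) * M ^ (Fintype.card κ - #S) := by gcongr
      _ = M ^ (#S + (Fintype.card κ - #S)) * 2 ^ (2 * E) := by rw [pow_add]; ring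
      _ = _ := by rw [Nat.add_sub_cancel' (Finset.card_le_univ S)]
  have h6 := h1.trans h2
  have h7 : 2 ^ (8 * E) = 2 ^ (6 * E) * 2 ^ (2 * E) := by rw [← pow_add]; congr 1; omega
  rw [h7, ← mul_assoc] at h6
  exact Nat.le_of_mul_le_mul_right h6 (by positivity)

/-- Lets the union bound run over J-tuples instead of sets of size at most J. -/
theorem exists_fin_image_superset {α : Type*} [DecidableEq α] [Nonempty α] {X : Finset α} {J : ℕ}
    (h : #X ≤ J) : ∃ a : Fin J → α, X ⊆ univ.image a := by
  refine ⟨fun i => if hi : i.1 < #X then X.equivFin.symm ⟨i, hi⟩ else Classical.arbitrary α,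
    fun x hx => ?_⟩
  have h1 := (X.equivFin ⟨x, hx⟩).2
  refine mem_image.2 ⟨⟨X.equivFin ⟨x, hx⟩, h1.trans_le h⟩, mem_univ _, ?_⟩
  simp

/-- Union bound: each of the N^J·N^J·M choices of two J-tuples and a value spoils at most a fraction
2^(-6E) of all functions. E bounds the average J^2/M. -/
theorem exists_balanced_function {N M J E : ℕ} (hN : 0 < N) (hJ : J * J ≤ M * E)
    (hE : N ^ J * N ^ J * M < 2 ^ (6 * E)) (hM : 0 < M) :
    ∃ F : Fin N × Fin N → Fin M, ∀ X Y : Finset (Fin N), #X ≤ J → #Y ≤ J → ∀ z,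
      #{p ∈ X ×ˢ Y | F p = z} ≤ 8 * E := by
  by_contra! hcon
  have : Nonempty (Fin N) := ⟨⟨0, hN⟩⟩
  let S : (Fin J → Fin N) × (Fin J → Fin N) → Finset (Fin N × Fin N) :=
    fun q => univ.image q.1 ×ˢ univ.image q.2
  have hcover : (univ : Finset (Fin N × Fin N → Fin M)) ⊆
      (univ : Finset (((Fin J → Fin N) × (Fin J → Fin N)) × Fin M)).biUnion fun q =>
        {F | 8 * E < #{k ∈ S q.1 | F k = q.2}} := by
    intro F _
    obtain ⟨X, Y, hX, hY, z, hz⟩ := hcon F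
    obtain ⟨a, ha⟩ := exists_fin_image_superset hX
    obtain ⟨b, hb⟩ := exists_fin_image_superset hY
    refine mem_biUnion.2 ⟨((a, b), z), mem_univ _, mem_filter.2 ⟨mem_univ _, hz.trans_le ?_⟩⟩
    exact card_le_card (filter_subset_filter _ (product_subset_product ha hb))
  have h1 := (card_le_card hcover).trans card_biUnion_le
  have h2 : ∀ q : ((Fin J → Fin N) × (Fin J → Fin N)) × Fin M,
      #{F : Fin N × Fin N → Fin M | 8 * E < #{k ∈ S q.1 | F k = q.2}} * 2 ^ (6 * E) ≤
        M ^ Fintype.card (Fin N × Fin N) := fun q => by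
    refine card_heavy_functions_le _ (le_trans ?_ hJ) _
    rw [card_product]
    exact Nat.mul_le_mul (card_image_le.trans (by simp)) (card_image_le.trans (by simp))
  have h3 := Nat.mul_le_mul_right (2 ^ (6 * E)) h1
  rw [Finset.sum_mul] at h3
  have h4 := h3.trans (Finset.sum_le_card_nsmul _ _ _ fun q _ => h2 q)
  rw [smul_eq_mul, card_univ, card_univ, Fintype.card_fun, mul_comm, Fintype.card_fin] at h4
  have h5 := Nat.le_of_mul_le_mul_right h4 (by positivity)
  simp only [Fintype.card_prod, Fintype.card_fun, Fintype.card_fin] at h5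
  omega

end Existence

/-- The entry in row `u` and column `v` of the `N × N` table with values below `M` that is coded by
the base-`M` digits of `T`. -/
def tableEntry (N M T u v : ℕ) : ℕ := T / M ^ (v + N * u) % M

/-- The size of the subset of `{0, …, N - 1}` coded by the binary digits of `X`. -/
def bitCount (N X : ℕ) : ℕ := ∑ u ∈ Finset.range N, (X.testBit u).toNat

/-- The number of entries `z` in the rows coded by `X` and the columns coded by `Y`. -/
def cellCount (N M T X Y z : ℕ) : ℕ :=
  ∑ u ∈ Finset.range N, ∑ v ∈ Finset.range N,
    if X.testBit u = true ∧ Y.testBit v = true ∧ tableEntry N M T u v = z then 1 else 0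

/-- Every value occurs at most `r` times in every rectangle with sides at most `J`. -/
def IsBalancedTable (N M J r T : ℕ) : Prop :=
  ∀ X < 2 ^ N, ∀ Y < 2 ^ N, ∀ z < M, bitCount N X ≤ J → bitCount N Y ≤ J →
    cellCount N M T X Y z ≤ r

instance (N M J r T : ℕ) : Decidable (IsBalancedTable N M J r T) := by
  unfold IsBalancedTable; infer_instance

/-! ### Sets and tables coded by numbers; large rectangles -/

section Coding

open Finset

theorem bitCount_eq_card (N X : ℕ) : bitCount N X = #{u ∈ range N | X.testBit u = true} := by
  rw [bitCount, card_filter]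
  exact sum_congr rfl fun u _ => by cases X.testBit u <;> rfl

theorem cellCount_eq_card (N M T X Y z : ℕ) : cellCount N M T X Y z =
    #{p ∈ {u ∈ range N | X.testBit u = true} ×ˢ {v ∈ range N | Y.testBit v = true} |
      tableEntry N M T p.1 p.2 = z} := by
  rw [cellCount, ← sum_product', ← card_filter]
  congr 1
  ext ⟨u, v⟩
  simp only [mem_filter, mem_product, mem_range]
  tauto

theorem exists_testBit_eq {N : ℕ} {X : Finset ℕ} (hX : X ⊆ range N) :
    ∃ c < 2 ^ N, {u ∈ range N | c.testBit u = true} = X := by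
  refine ⟨Nat.ofBits fun i : Fin N => decide (i.1 ∈ X), Nat.ofBits_lt_two_pow _, ?_⟩
  ext u
  simp only [mem_filter, mem_range]
  constructor
  · rintro ⟨hu, h⟩
    rw [Nat.testBit_ofBits_lt _ _ hu] at h
    simpa using h
  · intro hu
    have hu' := mem_range.1 (hX hu)
    refine ⟨hu', ?_⟩
    rw [Nat.testBit_ofBits_lt _ _ hu']
    simpa using hu

theorem IsBalancedTable.card_le {N M J r T : ℕ} (h : IsBalancedTable N M J r T) {X Y : Finset ℕ}
    (hX : X ⊆ range N) (hY : Y ⊆ range N) (hXJ : #X ≤ J) (hYJ : #Y ≤ J) {z : ℕ} (hz : z < M) :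
    #{p ∈ X ×ˢ Y | tableEntry N M T p.1 p.2 = z} ≤ r := by
  obtain ⟨a, ha, rfl⟩ := exists_testBit_eq hX
  obtain ⟨b, hb, rfl⟩ := exists_testBit_eq hY
  rw [← cellCount_eq_card]
  exact h a ha b hb z hz (by rwa [bitCount_eq_card]) (by rwa [bitCount_eq_card])

theorem exists_isBalancedTable {N M J E : ℕ} (hN : 0 < N) (hJ : J * J ≤ M * E)
    (hE : N ^ J * N ^ J * M < 2 ^ (6 * E)) (hM : 0 < M) :
    ∃ T < M ^ (N * N), IsBalancedTable N M J (8 * E) T := by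
  obtain ⟨F, hF⟩ := exists_balanced_function hN hJ hE hM
  -- `finFunctionFinEquiv` reads G as base-M digits, and `finProdFinEquiv` sends (u, v) to v + N·u,
  -- the digit position used in `tableEntry`.
  let G : Fin (N * N) → Fin M := F ∘ finProdFinEquiv.symm
  refine ⟨finFunctionFinEquiv G, (finFunctionFinEquiv G).2, ?_⟩
  have hG : ∀ u v : Fin N, tableEntry N M (finFunctionFinEquiv G : ℕ) u v = (F (u, v) : ℕ) := by
    intro u v
    have h1 := congrArg Fin.val
      (congrFun (Equiv.symm_apply_apply finFunctionFinEquiv G) (finProdFinEquiv (u, v)))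
    have h2 : G (finProdFinEquiv (u, v)) = F (u, v) := by simp [G]
    rw [h2] at h1
    exact h1
  intro X _ Y _ z hz hX hY
  let bits : ℕ → Finset (Fin N) := fun X => {u | X.testBit u = true}
  have hbits : ∀ X, {u ∈ range N | X.testBit u = true} = (bits X).map Fin.valEmbedding := by
    intro X
    ext u
    simp only [mem_filter, mem_range, mem_map, Fin.valEmbedding_apply, bits, mem_univ, true_and]
    exact ⟨fun h => ⟨⟨u, h.1⟩, h.2, rfl⟩, by rintro ⟨a, ha, rfl⟩; exact ⟨a.2, ha⟩⟩
  rw [bitCount_eq_card, hbits, card_map] at hX hY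
  refine le_trans (le_of_eq ?_) (hF _ _ hX hY ⟨z, hz⟩)
  rw [cellCount_eq_card, hbits, hbits]
  symm
  refine card_bij (fun p _ => (p.1.1, p.2.1)) ?_ ?_ ?_
  · rintro ⟨u, v⟩ h
    simp only [mem_filter, mem_product] at h
    simp only [mem_filter, mem_product, hG, h.2]
    exact ⟨⟨mem_map_of_mem _ h.1.1, mem_map_of_mem _ h.1.2⟩, trivial⟩
  · rintro ⟨u, v⟩ _ ⟨u', v'⟩ _ h
    simpa [Fin.ext_iff] using h
  · rintro ⟨u, v⟩ h
    simp only [mem_filter, mem_product, mem_map] at h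
    obtain ⟨⟨⟨u, hu, rfl⟩, ⟨v, hv, rfl⟩⟩, h⟩ := h
    refine ⟨(u, v), ?_, rfl⟩
    simp only [Fin.valEmbedding_apply, hG] at h
    simp only [mem_filter, mem_product]
    exact ⟨⟨hu, hv⟩, Fin.ext h⟩

/-- A subadditive bound for small sets extends to large sets. -/
theorem le_mul_of_subadditive {α : Type*} [DecidableEq α] {μ : Finset α → ℕ}
    (hμ : ∀ X Y, μ (X ∪ Y) ≤ μ X + μ Y) {J r : ℕ} {A : Finset α}
    (h : ∀ X ⊆ A, #X ≤ J → μ X ≤ r) (p : ℕ) {X : Finset α}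
    (hXA : X ⊆ A) (hX : #X ≤ J * (p + 1)) : μ X ≤ (p + 1) * r := by
  induction p generalizing X with
  | zero => simpa using h X hXA (by simpa using hX)
  | succ p ih =>
    -- Split off one piece of at most J elements; the remainder needs one piece fewer.
    obtain ⟨Y, hY, hYc⟩ := exists_subset_card_eq (min_le_right J #X)
    rw [← union_sdiff_of_subset hY]
    refine (hμ _ _).trans ?_
    have h1 := h Y (hY.trans hXA) (hYc.le.trans (min_le_left _ _))
    have h2 := ih (X := X \ Y) (sdiff_subset.trans hXA) (by
      rw [card_sdiff_of_subset hY, hYc]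
      rw [mul_add J (p + 1) 1, mul_one] at hX
      omega)
    rw [add_mul (p + 1) 1, one_mul, add_comm]
    exact Nat.add_le_add h2 h1

/-- Cut the sides into p and q pieces of size at most J; each of the pq small rectangles contains a
given value at most r times. -/
theorem IsBalancedTable.card_le_mul {N M J r T : ℕ} (h : IsBalancedTable N M J r T)
    {X Y Z : Finset ℕ} (hX : X ⊆ range N) (hY : Y ⊆ range N) (hZ : Z ⊆ range M) {p q : ℕ}
    (hp : 0 < p) (hq : 0 < q) (hXJ : #X ≤ J * p) (hYJ : #Y ≤ J * q) :
    #{c ∈ X ×ˢ Y | tableEntry N M T c.1 c.2 ∈ Z} ≤ #Z * (p * (q * r)) := by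
  obtain ⟨p, rfl⟩ : ∃ p', p = p' + 1 := ⟨p - 1, by omega⟩
  obtain ⟨q, rfl⟩ : ∃ q', q = q' + 1 := ⟨q - 1, by omega⟩
  have h1 : ∀ z ∈ Z, #{c ∈ X ×ˢ Y | tableEntry N M T c.1 c.2 = z} ≤
      (p + 1) * ((q + 1) * r) := by
    intro z hz
    let μ : Finset ℕ → Finset ℕ → ℕ := fun X Y =>
      #{c ∈ X ×ˢ Y | tableEntry N M T c.1 c.2 = z}
    have hμ₁ : ∀ X X' Y, μ (X ∪ X') Y ≤ μ X Y + μ X' Y := fun X X' Y => by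
      simp only [μ]
      rw [union_product, filter_union]
      exact card_union_le _ _
    have hμ₂ : ∀ X Y Y', μ X (Y ∪ Y') ≤ μ X Y + μ X Y' := fun X Y Y' => by
      simp only [μ]
      rw [product_union, filter_union]
      exact card_union_le _ _
    have hμ : ∀ X ⊆ range N, #X ≤ J → ∀ Y ⊆ range N, #Y ≤ J → μ X Y ≤ r :=
      fun X hX hXJ Y hY hYJ => h.card_le hX hY hXJ hYJ (mem_range.1 (hZ hz))
    change μ X Y ≤ _
    clear_value μ
    exact le_mul_of_subadditive (μ := fun X => μ X Y) (fun X X' => hμ₁ X X' Y)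
      (fun X hX hXJ => le_mul_of_subadditive (hμ₂ X) (hμ X hX hXJ) q hY hYJ) p hX hXJ
  have h2 : {c ∈ X ×ˢ Y | tableEntry N M T c.1 c.2 ∈ Z} ⊆
      Z.biUnion fun z => {c ∈ X ×ˢ Y | tableEntry N M T c.1 c.2 = z} := by
    intro c hc
    simp only [mem_filter] at hc
    simp only [mem_biUnion, mem_filter]
    exact ⟨_, hc.2, hc.1, rfl⟩
  refine (card_le_card h2).trans (card_biUnion_le.trans ?_)
  exact sum_le_card_nsmul _ _ _ h1

/-- The numbers below `2 ^ m` whose digits at positions in `[a, b)` are given. -/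
theorem card_testBit_eq_le (f : ℕ → Bool) {a b m : ℕ} (hbm : b ≤ m) :
    #{z ∈ range (2 ^ m) | ∀ i, a ≤ i → i < b → z.testBit i = f i} ≤ 2 ^ a * 2 ^ (m - b) := by
  have h : #(range (2 ^ a) ×ˢ range (2 ^ (m - b))) = 2 ^ a * 2 ^ (m - b) := by
    rw [card_product, card_range, card_range]
  rw [← h]
  -- Only the digits below a and those from b upwards remain free.
  refine card_le_card_of_injOn (fun z => (z % 2 ^ a, z / 2 ^ b)) ?_ ?_
  · intro z hz
    simp only [coe_filter, mem_range, Set.mem_ofPred_eq] at hz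
    simp only [coe_product, coe_range, Set.mem_prod, Set.mem_Iio]
    refine ⟨Nat.mod_lt _ (by positivity), Nat.div_lt_of_lt_mul ?_⟩
    rw [← pow_add, Nat.add_sub_cancel' hbm]
    exact hz.1
  · intro z hz z' hz' hzz
    simp only [coe_filter, mem_range, Set.mem_ofPred_eq] at hz hz'
    simp only [Prod.mk.injEq] at hzz
    refine Nat.eq_of_testBit_eq fun i => ?_
    by_cases hia : i < a
    · have := congrArg (Nat.testBit · i) hzz.1
      simpa [Nat.testBit_mod_two_pow, hia] using this
    · by_cases hib : i < b
      · rw [hz.2 i (by omega) hib, hz'.2 i (by omega) hib]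
      · have := congrArg (Nat.testBit · (i - b)) hzz.2
        simp only [Nat.testBit_div_two_pow] at this
        rwa [Nat.sub_add_cancel (by omega)] at this

end Coding

/-! ### Primitive recursiveness of the tables -/

section PrimrecTables

open Primrec

variable {α : Type*} [Primcodable α]

theorem primrec_pow : Primrec₂ ((· ^ ·) : ℕ → ℕ → ℕ) :=
  Primrec₂.unpaired'.1 Nat.Primrec.pow

theorem primrec_testBit : Primrec₂ Nat.testBit := by
  have h : PrimrecRel fun n i : ℕ => n / 2 ^ i % 2 = 1 :=
    Primrec.eq.comp (nat_mod.comp (nat_div.comp fst (primrec_pow.comp (const 2) snd)) (const 2))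
      (const 1)
  exact h.decide.of_eq fun n i => (Nat.testBit_eq_decide_div_mod_eq ..).symm

theorem primrec_sum {g : α → ℕ} {f : α → ℕ → ℕ} (hg : Primrec g) (hf : Primrec₂ f) :
    Primrec fun a => ∑ i ∈ Finset.range (g a), f a i := by
  refine (nat_rec' (h := fun a p => p.2 + f a p.1) hg (const 0)
    (nat_add.comp (snd.comp snd) (hf.comp fst (fst.comp snd))).to₂).of_eq fun a => ?_
  induction g a with
  | zero => rfl
  | succ n ih => rw [Finset.sum_range_succ, ← ih]

theorem primrecPred_forall_lt {g : α → ℕ} {R : α → ℕ → Prop} (hg : Primrec g)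
    (hR : PrimrecPred fun q : α × ℕ => R q.1 q.2) : PrimrecPred fun a => ∀ i < g a, R a i :=
  ((PrimrecRel.forall_mem_list (R := fun (i : ℕ) (a : α) => R a i)
    (hR.comp (pair snd fst))).comp (list_range.comp hg) Primrec.id).of_eq fun a => by simp

theorem primrecPred_imp {p q : α → Prop} (hp : PrimrecPred p) (hq : PrimrecPred q) :
    PrimrecPred fun a => p a → q a :=
  (hp.not.or hq).of_eq fun _ => imp_iff_not_or.symm

theorem primrec_tableEntry {N M T u v : α → ℕ} (hN : Primrec N) (hM : Primrec M)
    (hT : Primrec T) (hu : Primrec u) (hv : Primrec v) :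
    Primrec fun a => tableEntry (N a) (M a) (T a) (u a) (v a) :=
  nat_mod.comp (nat_div.comp hT (primrec_pow.comp hM (nat_add.comp hv (nat_mul.comp hN hu)))) hM

theorem primrec_bitCount {N X : α → ℕ} (hN : Primrec N) (hX : Primrec X) :
    Primrec fun a => bitCount (N a) (X a) :=
  primrec_sum hN ((dom_bool Bool.toNat).comp (primrec_testBit.comp (hX.comp fst) snd)).to₂

theorem primrec_cellCount {N M T X Y z : α → ℕ} (hN : Primrec N) (hM : Primrec M)
    (hT : Primrec T) (hX : Primrec X) (hY : Primrec Y) (hz : Primrec z) :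
    Primrec fun a => cellCount (N a) (M a) (T a) (X a) (Y a) (z a) := by
  refine primrec_sum hN (primrec_sum (hN.comp fst) ?_)
  have ha : Primrec fun q : (α × ℕ) × ℕ => q.1.1 := fst.comp fst
  have hu : Primrec fun q : (α × ℕ) × ℕ => q.1.2 := snd.comp fst
  refine Primrec.ite (PrimrecPred.and ?_ (PrimrecPred.and ?_ ?_)) (const 1) (const 0)
  · exact Primrec.eq.comp (primrec_testBit.comp (hX.comp ha) hu) (const true)
  · exact Primrec.eq.comp (primrec_testBit.comp (hY.comp ha) snd) (const true)
  · exact Primrec.eq.comp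
      (primrec_tableEntry (hN.comp ha) (hM.comp ha) (hT.comp ha) hu snd) (hz.comp ha)

theorem primrecPred_isBalancedTable {N M J r T : α → ℕ} (hN : Primrec N) (hM : Primrec M)
    (hJ : Primrec J) (hr : Primrec r) (hT : Primrec T) :
    PrimrecPred fun a => IsBalancedTable (N a) (M a) (J a) (r a) (T a) := by
  have hpow : Primrec fun a => 2 ^ N a := primrec_pow.comp (const 2) hN
  refine primrecPred_forall_lt hpow (primrecPred_forall_lt (hpow.comp fst)
    (primrecPred_forall_lt (hM.comp (fst.comp fst)) ?_))
  have ha : Primrec fun q : ((α × ℕ) × ℕ) × ℕ => q.1.1.1 := fst.comp (fst.comp fst)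
  have hX : Primrec fun q : ((α × ℕ) × ℕ) × ℕ => q.1.1.2 := snd.comp (fst.comp fst)
  have hY : Primrec fun q : ((α × ℕ) × ℕ) × ℕ => q.1.2 := snd.comp fst
  refine primrecPred_imp (nat_le.comp (primrec_bitCount (hN.comp ha) hX) (hJ.comp ha))
    (primrecPred_imp (nat_le.comp (primrec_bitCount (hN.comp ha) hY) (hJ.comp ha)) ?_)
  exact nat_le.comp
    (primrec_cellCount (hN.comp ha) (hM.comp ha) (hT.comp ha) hX hY snd) (hr.comp ha)

end PrimrecTables

/-! ### The table attached to a block -/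

/-- The code of a balanced table of `B ^ 2`-bit numbers with rows and columns indexed by
`B ^ 4`-bit numbers. -/
def blockTable (B : ℕ) : ℕ :=
  Nat.findGreatest
    (fun T => IsBalancedTable (2 ^ B ^ 4) (2 ^ B ^ 2) (2 ^ (2 * B ^ 2)) (8 * 2 ^ (3 * B ^ 2)) T)
    ((2 ^ B ^ 2) ^ (2 ^ B ^ 4 * 2 ^ B ^ 4))

/-- The entry of `blockTable B` in row `u` and column `v`. -/
def blockEntry (B u v : ℕ) : ℕ := tableEntry (2 ^ B ^ 4) (2 ^ B ^ 2) (blockTable B) u v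

theorem isBalancedTable_blockTable {B : ℕ} (hB : 2 ≤ B) :
    IsBalancedTable (2 ^ B ^ 4) (2 ^ B ^ 2) (2 ^ (2 * B ^ 2)) (8 * 2 ^ (3 * B ^ 2))
      (blockTable B) := by
  have h1 : 2 ^ (2 * B ^ 2) * 2 ^ (2 * B ^ 2) ≤ 2 ^ B ^ 2 * 2 ^ (3 * B ^ 2) := by
    rw [← pow_add, ← pow_add]
    exact Nat.pow_le_pow_right (by simp) (by omega)
  have h4 : 4 ≤ B ^ 2 := by nlinarith
  -- m^2 ≤ 2^m for m ≥ 4, with m = B^2. This keeps the exponent 2·B^4·2^(2B^2) + B^2 of the union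
  -- bound below 6·2^(3B^2).
  have h2 : B ^ 4 ≤ 2 ^ B ^ 2 := by
    rw [show B ^ 4 = (B ^ 2) ^ 2 by ring]
    generalize B ^ 2 = m at h4
    induction m, h4 using Nat.le_induction with
    | base => norm_num
    | succ m hm ih => rw [pow_succ 2]; nlinarith
  have h3 : (2 ^ B ^ 4) ^ 2 ^ (2 * B ^ 2) * (2 ^ B ^ 4) ^ 2 ^ (2 * B ^ 2) * 2 ^ B ^ 2 <
      2 ^ (6 * 2 ^ (3 * B ^ 2)) := by
    rw [← pow_mul, ← pow_add, ← pow_add]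
    refine Nat.pow_lt_pow_right (by simp) ?_
    have h5 : B ^ 4 * 2 ^ (2 * B ^ 2) ≤ 2 ^ (3 * B ^ 2) := by
      rw [show 3 * B ^ 2 = B ^ 2 + 2 * B ^ 2 by ring, pow_add]
      gcongr
    have h6 : B ^ 2 < 2 ^ (3 * B ^ 2) :=
      Nat.lt_two_pow_self.trans_le (Nat.pow_le_pow_right (by simp) (by omega))
    omega
  obtain ⟨T, hT, hT'⟩ := exists_isBalancedTable (by positivity) h1 h3 (by positivity)
  exact Nat.findGreatest_spec (P := fun T => IsBalancedTable _ _ _ _ T) hT.le hT'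

/-- The search for the table is bounded by the number of all tables and balance is a primitive
recursive predicate, so the extractor halts with all oracles. -/
theorem primrec_blockEntry {α : Type*} [Primcodable α] {B u v : α → ℕ} (hB : Primrec B)
    (hu : Primrec u) (hv : Primrec v) : Primrec fun a => blockEntry (B a) (u a) (v a) := by
  open Primrec in
  have h2 : ∀ k : ℕ, Primrec fun a => B a ^ k := fun k => primrec_pow.comp hB (const k)
  have hp : ∀ {g : α → ℕ}, Primrec g → Primrec fun a => 2 ^ g a := fun hg =>
    primrec_pow.comp (const 2) hg
  have hN := hp (h2 4)
  have hM := hp (h2 2)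
  have hJ := hp (nat_mul.comp (const 2) (h2 2))
  have hr := nat_mul.comp (const 8) (hp (nat_mul.comp (const 3) (h2 2)))
  have hT : Primrec fun a => blockTable (B a) :=
    nat_findGreatest (primrec_pow.comp hM (nat_mul.comp hN hN))
      (primrecPred_isBalancedTable (hN.comp fst) (hM.comp fst) (hJ.comp fst) (hr.comp fst) snd)
  exact primrec_tableEntry hN hM hT hu hv

/-! ### The extractor and its oracle machine -/

/-- The largest number `2 ^ 2 ^ i` which is at most `n`, for `n ≥ 2`. -/
def blockBase (n : ℕ) : ℕ := 2 ^ 2 ^ Nat.log 2 (Nat.log 2 n)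

theorem primrec_natLog_two : Primrec (Nat.log 2) := by
  have h : PrimrecRel fun n k : ℕ => 2 ^ k ≤ n :=
    Primrec.nat_le.comp (primrec_pow.comp (Primrec.const 2) Primrec.snd) Primrec.fst
  refine (Primrec.nat_findGreatest Primrec.id h).of_eq fun n => ?_
  rcases Nat.eq_zero_or_pos n with rfl | hn
  · simp
  · refine Nat.findGreatest_eq_iff.2 ⟨Nat.log_le_self 2 n, fun _ => ?_, fun {k} hk _ => ?_⟩
    · exact Nat.pow_log_le_self 2 hn.ne'
    · exact not_le.2 ((Nat.log_lt_iff_lt_pow (by norm_num) hn.ne').1 hk)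

theorem primrec_blockBase : Primrec blockBase :=
  primrec_pow.comp (Primrec.const 2) (primrec_pow.comp (Primrec.const 2)
    (primrec_natLog_two.comp primrec_natLog_two))

/-- The digit at position `n` of the block entry determined by the strings with codes `u`, `v`. -/
def extractBit (n u v : ℕ) : Bool := (blockEntry (blockBase n) u v).testBit n

theorem primrec_extractBit {α : Type*} [Primcodable α] {n u v : α → ℕ} (hn : Primrec n)
    (hu : Primrec u) (hv : Primrec v) : Primrec fun a => extractBit (n a) (u a) (v a) :=
  primrec_testBit.comp (primrec_blockEntry (primrec_blockBase.comp hn) hu hv) hn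

/-- The extractor: the bits at positions in `[B, B ^ 2)`, for `B = 2 ^ 2 ^ i`, are taken from the
entry of a balanced table in the row `x(1:B ^ 4)` and the column `y(1:B ^ 4)`. -/
def extractor (x y : BinSeq) : BinSeq := fun n =>
  extractBit n (bitsToNat (initSeg x (blockBase n ^ 4))) (bitsToNat (initSeg y (blockBase n ^ 4)))

theorem initSeg_succ (x : BinSeq) (n : ℕ) : initSeg x (n + 1) = initSeg x n ++ [x n] := by
  simp [initSeg, List.range_succ]

@[simp] theorem length_initSeg (x : BinSeq) (n : ℕ) : (initSeg x n).length = n := by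
  simp [initSeg]

theorem take_initSeg (x : BinSeq) {n m : ℕ} (h : n ≤ m) :
    (initSeg x m).take n = initSeg x n := by
  rw [initSeg, ← List.map_take, List.take_range, min_eq_left h, initSeg]

/-! ### Oracle programs for primitive recursive functions and for oracle prefixes -/

namespace OracleCode

variable {x y : BinSeq} {F G : OracleCode} {n a b : ℕ}

theorem eval_pair_eq (hF : F.eval x y n = Part.some a) (hG : G.eval x y n = Part.some b) :
    (pair F G).eval x y n = Part.some (Nat.pair a b) := by
  change (F.eval x y n).bind (fun a => (G.eval x y n).map fun b => Nat.pair a b) = _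
  rw [hF, hG]
  exact (Part.bind_some _ _).trans (Part.map_some _ _)

theorem eval_comp_eq (hG : G.eval x y n = Part.some b) (hF : F.eval x y b = Part.some a) :
    (comp F G).eval x y n = Part.some a := by
  change (G.eval x y n).bind (F.eval x y) = _
  rw [hG]
  exact (Part.bind_some _ _).trans hF

theorem eval_prec_eq {r : ℕ → ℕ} (hF : F.eval x y a = Part.some (r 0))
    (hG : ∀ k, G.eval x y (Nat.pair a (Nat.pair k (r k))) = Part.some (r (k + 1))) :
    (prec F G).eval x y (Nat.pair a n) = Part.some (r n) := by
  change Nat.rec (motive := fun _ => Part ℕ) (F.eval x y (Nat.pair a n).unpair.1)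
    (fun k IH => IH.bind fun i =>
      G.eval x y (Nat.pair (Nat.pair a n).unpair.1 (Nat.pair k i))) (Nat.pair a n).unpair.2 = _
  rw [Nat.unpair_pair]
  induction n with
  | zero => exact hF
  | succ k ih =>
    refine (congrArg (fun p => Part.bind p _) ih).trans ?_
    exact (Part.bind_some _ _).trans (hG k)

theorem exists_eval_of_natPrimrec {f : ℕ → ℕ} (hf : Nat.Primrec f) :
    ∃ M : OracleCode, ∀ x y n, M.eval x y n = Part.some (f n) := by
  induction hf with
  | zero => exact ⟨zero, fun _ _ _ => rfl⟩
  | succ => exact ⟨succ, fun _ _ _ => rfl⟩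
  | left => exact ⟨left, fun _ _ _ => rfl⟩
  | right => exact ⟨right, fun _ _ _ => rfl⟩
  | pair _ _ hf hg =>
    obtain ⟨F, hF⟩ := hf
    obtain ⟨G, hG⟩ := hg
    exact ⟨pair F G, fun x y n => eval_pair_eq (hF x y n) (hG x y n)⟩
  | comp _ _ hf hg =>
    obtain ⟨F, hF⟩ := hf
    obtain ⟨G, hG⟩ := hg
    exact ⟨comp F G, fun x y n => eval_comp_eq (hG x y n) (hF x y _)⟩
  | @prec f g _ _ hf hg =>
    obtain ⟨F, hF⟩ := hf
    obtain ⟨G, hG⟩ := hg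
    refine ⟨prec F G, fun x y p => ?_⟩
    have h := eval_prec_eq (x := x) (y := y) (F := F) (G := G) (a := p.unpair.1) (n := p.unpair.2)
      (r := fun n => n.rec (f p.unpair.1) fun k IH => g (Nat.pair p.unpair.1 (Nat.pair k IH)))
      (hF _ _ _) (fun k => hG _ _ _)
    rw [Nat.pair_unpair] at h
    exact h

theorem exists_eval_of_primrec {f : ℕ → ℕ} (hf : Primrec f) :
    ∃ M : OracleCode, ∀ x y n, M.eval x y n = Part.some (f n) :=
  exists_eval_of_natPrimrec (Primrec.nat_iff.1 hf)

/-- From a code for the digits of a sequence computable in the oracles, a code for the numbers of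
its initial segments. -/
theorem exists_eval_bitsToNat (Q : OracleCode) : ∃ M : OracleCode, ∀ x y w : BinSeq,
    (∀ n, Q.eval x y n = Part.some (w n).toNat) →
      ∀ n, M.eval x y n = Part.some (bitsToNat (initSeg w n)) := by
  have hk : Primrec fun p : ℕ => p.unpair.2.unpair.1 :=
    Primrec.fst.comp (Primrec.unpair.comp (Primrec.snd.comp Primrec.unpair))
  obtain ⟨K, hK⟩ := exists_eval_of_primrec hk
  obtain ⟨S, hS⟩ := exists_eval_of_primrec (f := fun p : ℕ =>
      p.unpair.1.unpair.2.unpair.2 + p.unpair.2 * 2 ^ p.unpair.1.unpair.2.unpair.1) <| by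
    have h1 : Primrec fun p : ℕ => p.unpair.1.unpair.2.unpair :=
      Primrec.unpair.comp (Primrec.snd.comp (Primrec.unpair.comp
        (Primrec.fst.comp Primrec.unpair)))
    exact Primrec.nat_add.comp (Primrec.snd.comp h1) (Primrec.nat_mul.comp
      (Primrec.snd.comp Primrec.unpair)
      (primrec_pow.comp (Primrec.const 2) (Primrec.fst.comp h1)))
  obtain ⟨P, hP⟩ := exists_eval_of_primrec (f := fun n => Nat.pair 0 n)
    (Primrec₂.natPair.comp (Primrec.const 0) Primrec.id)
  obtain ⟨I, hI⟩ := exists_eval_of_primrec Primrec.id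
  -- P supplies a dummy parameter 0 for the recursion. Digits are least significant first, so stage
  -- k adds the bit at position k times 2^k.
  refine ⟨comp (prec zero (comp S (pair I (comp Q K)))) P, fun x y w hQ n => ?_⟩
  refine eval_comp_eq (hP x y n) (eval_prec_eq (r := fun n => bitsToNat (initSeg w n)) rfl
    fun k => ?_)
  refine eval_comp_eq (eval_pair_eq (hI _ _ _) (eval_comp_eq (hK _ _ _) (hQ _))) ?_
  rw [hS, initSeg_succ, bitsToNat_concat, length_initSeg]
  simp

theorem exists_eval_extractor : ∃ M : OracleCode, ∀ (x y : BinSeq) (n : ℕ),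
    M.eval x y n = Part.some (extractor x y n).toNat := by
  obtain ⟨X, hX⟩ := exists_eval_bitsToNat query₁
  obtain ⟨Y, hY⟩ := exists_eval_bitsToNat query₂
  obtain ⟨L, hL⟩ := exists_eval_of_primrec
    (primrec_pow.comp primrec_blockBase (Primrec.const 4))
  obtain ⟨I, hI⟩ := exists_eval_of_primrec Primrec.id
  obtain ⟨E, hE⟩ := exists_eval_of_primrec (f := fun p : ℕ =>
      (extractBit p.unpair.1 p.unpair.2.unpair.1 p.unpair.2.unpair.2).toNat) <| by
    have h1 : Primrec fun p : ℕ => p.unpair.2.unpair :=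
      Primrec.unpair.comp (Primrec.snd.comp Primrec.unpair)
    exact (Primrec.dom_bool Bool.toNat).comp (primrec_extractBit
      (Primrec.fst.comp Primrec.unpair) (Primrec.fst.comp h1) (Primrec.snd.comp h1))
  refine ⟨comp E (pair I (pair (comp X L) (comp Y L))), fun x y n => ?_⟩
  refine eval_comp_eq (eval_pair_eq (hI x y n) (eval_pair_eq
    (eval_comp_eq (hL x y n) (hX x y x (fun _ => rfl) _))
    (eval_comp_eq (hL x y n) (hY x y y (fun _ => rfl) _)))) ?_
  rw [hE]
  simp [extractor]

end OracleCode

theorem isTruthTableReduction_extractor : IsTruthTableReduction extractor :=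
  OracleCode.exists_eval_extractor

theorem isUniformTruthTableReduction_const {f : BinSeq → BinSeq → BinSeq}
    (hf : IsTruthTableReduction f) : IsUniformTruthTableReduction fun _ => f := by
  obtain ⟨M, hM⟩ := hf
  exact ⟨M.comp .right, fun q x y n => OracleCode.eval_comp_eq rfl (by simp [hM])⟩

/-! ### Counting strings of bounded complexity -/

theorem exists_finset_of_encard_le {α : Type*} {S : Set α} {n : ℕ} (h : S.encard ≤ n) :
    ∃ A : Finset α, (∀ a, a ∈ A ↔ a ∈ S) ∧ A.card ≤ n := by
  have hfin : S.Finite := Set.finite_of_encard_le_coe h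
  refine ⟨hfin.toFinset, fun a => hfin.mem_toFinset, ?_⟩
  rw [hfin.encard_eq_coe_toFinset_card] at h
  exact_mod_cast h

/-- Positions are stable as the lists grow, so sending an element to its position below m is
injective on the union over all k. -/
theorem encard_take_enumList_le {β : Type*} [DecidableEq β] (e : ℕ → Option β) (m : ℕ) :
    {b | ∃ k, b ∈ (enumList e k).take m}.encard ≤ m := by
  have h : ∀ b : β, (∃ k, b ∈ (enumList e k).take m) →
      ∃ j < m, ∃ k, (enumList e k)[j]? = some b := by
    rintro b ⟨k, hb⟩
    obtain ⟨j, hj, hjb⟩ := List.getElem_of_mem hb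
    rw [List.length_take] at hj
    refine ⟨j, by omega, k, ?_⟩
    rw [← hjb, List.getElem_take, List.getElem?_eq_getElem]
  choose! f hf using h
  have h1 : Set.MapsTo f {b | ∃ k, b ∈ (enumList e k).take m} (Finset.range m : Finset ℕ) := by
    intro b hb
    simpa using (hf b hb).1
  refine (Set.encard_le_encard_of_injOn h1 ?_).trans ?_
  · intro b hb b' hb' hbb
    obtain ⟨-, k, hk⟩ := hf b hb
    obtain ⟨-, k', hk'⟩ := hf b' hb'
    have h1 := enumList_getElem?_mono (le_max_left k k') hk
    have h2 := enumList_getElem?_mono (le_max_right k k') hk'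
    rw [hbb, h2] at h1
    exact (Option.some.inj h1).symm
  · rw [Set.encard_coe_eq_coe_finsetCard, Finset.card_range]

/-- The computation coded by `w` runs `c` on a program of length at most `k` and yields `u`. -/
def OutputsWithin (c : Code) (k : ℕ) (u : List Bool) (w : ℕ) : Prop :=
  ((decode w.unpair.1 : Option (List Bool)).getD []).length ≤ k ∧
    c.evaln w.unpair.2 (encode ((decode w.unpair.1 : Option (List Bool)).getD [])) = some (encode u)

instance (c : Code) (k : ℕ) (u : List Bool) (w : ℕ) : Decidable (OutputsWithin c k u w) := by
  unfold OutputsWithin; infer_instance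

theorem primrecPred_outputsWithin (c : Code) {α : Type*} [Primcodable α] {k w : α → ℕ}
    {u : α → List Bool} (hk : Primrec k) (hu : Primrec u) (hw : Primrec w) :
    PrimrecPred fun a => OutputsWithin c (k a) (u a) (w a) := by
  have hw' : Primrec fun a => (w a).unpair := Primrec.unpair.comp hw
  have hp : Primrec fun a => (decode (w a).unpair.1 : Option (List Bool)).getD [] :=
    Primrec.option_getD.comp (Primrec.decode.comp (Primrec.fst.comp hw')) (Primrec.const [])
  refine PrimrecPred.and (Primrec.nat_le.comp (Primrec.list_length.comp hp) hk) ?_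
  exact Primrec.eq.comp (Code.primrec_evaln.comp (Primrec.pair
    (Primrec.pair (Primrec.snd.comp hw') (Primrec.const c)) (Primrec.encode.comp hp)))
    (Primrec.option_some.comp (Primrec.encode.comp hu))

/-- `c` is a code for the machine `U`. -/
def IsCodeOf (c : Code) (U : List Bool →. List Bool) : Prop :=
  ∀ p u, encode u ∈ c.eval (encode p) ↔ u ∈ U p

theorem exists_isCodeOf {U : List Bool →. List Bool} (hU : Partrec U) : ∃ c, IsCodeOf c U := by
  obtain ⟨c, hc⟩ := Code.exists_code.1 hU
  refine ⟨c, fun p u => ?_⟩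
  rw [hc]
  simp [Part.mem_map_iff]

namespace IsUniversalMachine

variable {U : List Bool →. List Bool} (hU : IsUniversalMachine U)
include hU

/-- The witness codes a program and a time bound, which makes K(u) ≤ k a projection of a primitive
recursive relation. An undecodable program is read as the empty one, which is harmless because the
run is still checked. -/
theorem exists_outputsWithin {c : Code} (hc : IsCodeOf c U) {k : ℕ} {u : List Bool} :
    (∃ w, OutputsWithin c k u w) ↔ plainK U u ≤ k := by
  constructor
  · rintro ⟨w, hw, hw'⟩
    exact (hU.plainK_le_length ((hc _ _).1 (Code.evaln_sound hw'))).trans hw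
  · intro h
    obtain ⟨p, hp, hpl⟩ := hU.exists_program u
    obtain ⟨s, hs⟩ := Code.evaln_complete.1 ((hc _ _).2 hp)
    refine ⟨Nat.pair (encode p) s, ?_, ?_⟩
    · simpa [hpl] using h
    · simpa using hs

theorem exists_finset_plainK_le (k : ℕ) :
    ∃ A : Finset (List Bool), (∀ u, u ∈ A ↔ plainK U u ≤ k) ∧ A.card ≤ 2 ^ (k + 1) := by
  choose f hf using hU.exists_program
  have h1 : Set.MapsTo f {u | plainK U u ≤ k} {p | p.length ≤ k} := by
    intro u hu
    exact (hf u).2.le.trans hu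
  have h2 : Set.InjOn f {u | plainK U u ≤ k} := fun u _ v _ huv =>
    Part.mem_unique (hf u).1 (huv ▸ (hf v).1)
  exact exists_finset_of_encard_le
    ((Set.encard_le_encard_of_injOn h1 h2).trans (encard_length_le k))

end IsUniversalMachine

/-! ### Extensions of a given prefix -/

/-- An enumeration of the strings of length `q.1` and complexity at most `q.2.1` which extend the
string `q.2.2`. -/
def extensionEnum (c : Code) (q : ℕ × ℕ × List Bool) : ℕ → Option (List Bool) :=
  enumOfRel fun u w => u.length = q.1 ∧ u.take q.2.2.length = q.2.2 ∧ OutputsWithin c q.2.1 u w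

theorem primrec_extensionEnum (c : Code) : Primrec₂ (extensionEnum c) := by
  refine primrec_enumOfRel ?_
  have hq : Primrec fun q : ((ℕ × ℕ × List Bool) × List Bool) × ℕ => q.1.1 :=
    Primrec.fst.comp Primrec.fst
  have hu : Primrec fun q : ((ℕ × ℕ × List Bool) × List Bool) × ℕ => q.1.2 :=
    Primrec.snd.comp Primrec.fst
  have hp := Primrec.snd.comp (Primrec.snd.comp hq)
  refine PrimrecPred.and (Primrec.eq.comp (Primrec.list_length.comp hu) (Primrec.fst.comp hq))
    (PrimrecPred.and (Primrec.eq.comp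
      (Primrec.list_take.comp (Primrec.list_length.comp hp) hu) hp) ?_)
  exact primrecPred_outputsWithin c (Primrec.fst.comp (Primrec.snd.comp hq)) hu Primrec.snd

theorem primrecPred_mem {α β : Type*} [Primcodable α] [Primcodable β] [DecidableEq β] {b : α → β}
    {l : α → List β} (hb : Primrec b) (hl : Primrec l) : PrimrecPred fun a => b a ∈ l a :=
  (Primrec.nat_lt.comp (Primrec.list_idxOf.comp hb hl) (Primrec.list_length.comp hl)).of_eq
    fun _ => List.idxOf_lt_length_iff

namespace IsUniversalMachine

variable {U : List Bool →. List Bool} (hU : IsUniversalMachine U)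
include hU

theorem exists_extensionEnum {c : Code} (hc : IsCodeOf c U) {q : ℕ × ℕ × List Bool}
    {u : List Bool} : (∃ k, extensionEnum c q k = some u) ↔
      u.length = q.1 ∧ u.take q.2.2.length = q.2.2 ∧ plainK U u ≤ q.2.1 := by
  rw [extensionEnum, exists_enumOfRel, ← hU.exists_outputsWithin hc]
  simp

/-- Double counting: distinct prefixes of one length have disjoint sets of extensions, all among the
at most 2^(k+1) strings of complexity at most k. -/
theorem card_mul_two_pow_le {c : Code} (hc : IsCodeOf c U) {t t' k m : ℕ} {F : Finset (List Bool)}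
    (hF : ∀ p ∈ F, p.length = t' ∧ ∃ l, 2 ^ m ≤ (enumList (extensionEnum c (t, k, p)) l).length) :
    F.card * 2 ^ m ≤ 2 ^ (k + 1) := by
  obtain ⟨A, hA, hAc⟩ := hU.exists_finset_plainK_le k
  refine le_trans ?_ hAc
  have h1 : ∀ p ∈ F, 2 ^ m ≤ (A.filter fun u => u.take t' = p).card := by
    intro p hp
    obtain ⟨hpt, l, hl⟩ := hF p hp
    refine hl.trans ?_
    rw [← List.toFinset_card_of_nodup (nodup_enumList _ l)]
    refine Finset.card_le_card fun u hu => ?_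
    rw [List.mem_toFinset, mem_enumList] at hu
    obtain ⟨i, -, hi⟩ := hu
    have h2 := (hU.exists_extensionEnum hc).1 ⟨i, hi⟩
    simp only [hpt] at h2
    exact Finset.mem_filter.2 ⟨(hA u).2 h2.2.2, h2.2.1⟩
  rw [← smul_eq_mul]
  refine (Finset.card_nsmul_le_sum _ _ _ h1).trans ?_
  rw [Finset.sum_card_fiberwise_eq_card_filter]
  exact Finset.card_filter_le _ _

/-- A string `u` is listed early among the extensions of a prefix of `u`. -/
theorem exists_mem_take_extensionEnum {c : Code} (hc : IsCodeOf c U) :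
    ∃ D, ∀ (u : List Bool) (t' a : ℕ), t' ≤ u.length → u.length < 2 ^ a →
      plainK U u + 2 < 2 ^ a →
      ∃ m, (∃ l, u ∈ (enumList (extensionEnum c (u.length, plainK U u, u.take t')) l).take (2 ^ m)) ∧
        m < 2 ^ a + 1 ∧ plainK U (u.take t') + m ≤ plainK U u + 16 * a + D := by
  -- R enumerates the prefixes having at least 2^m extensions of complexity at most k. There are at
  -- most 2^(k+1-m) of them, so each costs k + 1 - m bits up to logarithmic terms.
  let R : ℕ × List Bool → List Bool → ℕ → Prop := fun q p l =>
    p.length = q.1.unpair.2.unpair.2 ∧ 2 ^ q.1.unpair.2.unpair.1 ≤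
      (enumList (extensionEnum c (q.1.unpair.1.unpair.1, q.1.unpair.1.unpair.2, p)) l).length
  have hR : PrimrecPred fun q : ((ℕ × List Bool) × List Bool) × ℕ => R q.1.1 q.1.2 q.2 := by
    have hp : Primrec fun q : ((ℕ × List Bool) × List Bool) × ℕ => q.1.2 :=
      Primrec.snd.comp Primrec.fst
    have hq : Primrec fun q : ((ℕ × List Bool) × List Bool) × ℕ => q.1.1.1.unpair :=
      Primrec.unpair.comp (Primrec.fst.comp (Primrec.fst.comp Primrec.fst))
    have h1 := Primrec.unpair.comp (Primrec.fst.comp hq)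
    have h2 := Primrec.unpair.comp (Primrec.snd.comp hq)
    refine PrimrecPred.and (Primrec.eq.comp (Primrec.list_length.comp hp) (Primrec.snd.comp h2))
      (Primrec.nat_le.comp (primrec_pow.comp (Primrec.const 2) (Primrec.fst.comp h2)) ?_)
    exact Primrec.list_length.comp ((primrec_enumList (primrec_extensionEnum c)).comp
      (Primrec.pair (Primrec.fst.comp h1) (Primrec.pair (Primrec.snd.comp h1) hp)) Primrec.snd)
  have : ∀ q p, DecidablePred (R q p) := fun q p l => by
    simp only [R]; infer_instance
  obtain ⟨D, hD⟩ := hU.exists_plainK_le_of_enum (primrec_enumOfRel hR)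
  refine ⟨D + plainK U [] + 2, fun u t' a ht' hua hKa => ?_⟩
  set k := plainK U u with hk
  set p := u.take t' with hp
  have hpl : p.length = t' := by simp [hp, ht']
  obtain ⟨i, hi⟩ := (hU.exists_extensionEnum hc (q := (u.length, k, p)) (u := u)).2
    ⟨rfl, by change u.take p.length = p; rw [hpl], le_rfl⟩
  have hmem : u ∈ enumList (extensionEnum c (u.length, k, p)) (i + 1) :=
    mem_enumList.2 ⟨i, by omega, hi⟩
  obtain ⟨j, hj, hju⟩ := List.getElem_of_mem hmem
  -- The position j of u satisfies 2^m ≤ j + 1 < 2^(m+1): the list reaches 2^m entries, and u is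
  -- among the first 2^(m+1). The witness is therefore m + 1.
  set m := Nat.log 2 (j + 1) with hm
  have hm1 : 2 ^ m ≤ j + 1 := Nat.pow_log_le_self 2 (by omega)
  have hm2 : j + 1 < 2 ^ (m + 1) := Nat.lt_pow_succ_log_self (by norm_num) _
  have hmk : m ≤ k + 1 := by
    have h1 := hU.card_mul_two_pow_le hc (t := u.length) (t' := t') (k := k) (m := m) (F := {p})
      (by
        intro p' hp'
        rw [Finset.mem_singleton.1 hp']
        exact ⟨hpl, i + 1, by omega⟩)
    rw [Finset.card_singleton, one_mul] at h1
    exact (Nat.pow_le_pow_iff_right (by norm_num)).1 h1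
  refine ⟨m + 1, ⟨i + 1, ?_⟩, by omega, ?_⟩
  · rw [List.mem_iff_getElem]
    exact ⟨j, by rw [List.length_take]; omega, by rw [List.getElem_take, hju]⟩
  · have hcode : Nat.pair (Nat.pair u.length k) (Nat.pair m t') < 2 ^ (2 * (2 * a)) :=
      natPair_lt_two_pow (natPair_lt_two_pow hua (by omega))
        (natPair_lt_two_pow (by omega) (by omega))
    have h4 : (2 : ℕ) ^ a ≤ 2 ^ (2 * (2 * a)) := Nat.pow_le_pow_right (by simp) (by omega)
    -- Four numbers in a nested pair take 4a digits, whence 16a. The auxiliary string is empty and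
    -- costs the constant `plainK U []`.
    have h1 := hD (Nat.pair (Nat.pair u.length k) (Nat.pair m t')) [] (k + 1 - m) (2 * (2 * a)) p
      hcode (by omega) (exists_enumOfRel.2 ⟨i + 1, by
        simp only [R, Nat.unpair_pair]
        exact ⟨hpl, by omega⟩⟩) (fun l => by
        rw [← List.toFinset_card_of_nodup (nodup_enumList _ l)]
        refine Nat.le_of_mul_le_mul_right (c := 2 ^ m) ?_ (by positivity)
        rw [← pow_add, Nat.sub_add_cancel hmk]
        refine hU.card_mul_two_pow_le hc (t := u.length) (t' := t') fun p' hp' => ?_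
        rw [List.mem_toFinset, mem_enumList] at hp'
        obtain ⟨i', -, hi'⟩ := hp'
        obtain ⟨l', hl'⟩ := exists_enumOfRel.1 ⟨i', hi'⟩
        simp only [R, Nat.unpair_pair] at hl'
        exact ⟨hl'.1, l', hl'.2⟩)
    omega

end IsUniversalMachine

/-! ### Pairs of strings with a given extracted string -/

section PairCounting

open Finset

/-- At most 2^(a + B^2 - b) values have the prescribed digits, and each occurs at most 2^(c + d -
B^2 + 3) times. The bounds on c and d let the sides be cut into pieces of size 2^(2B^2). -/
theorem card_pairs_mul_two_pow_le {B : ℕ} (hB : 2 ≤ B) {X Y : Finset (List Bool)}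
    (hX : ∀ u ∈ X, u.length = B ^ 4) (hY : ∀ v ∈ Y, v.length = B ^ 4) {c d : ℕ}
    (hc : 2 * B ^ 2 ≤ c) (hd : 2 * B ^ 2 ≤ d) (hXc : #X ≤ 2 ^ c) (hYd : #Y ≤ 2 ^ d) {a b : ℕ}
    (hb : b ≤ B ^ 2) (f : ℕ → Bool) :
    #{p ∈ X ×ˢ Y | ∀ i, a ≤ i → i < b →
      (blockEntry B (bitsToNat p.1) (bitsToNat p.2)).testBit i = f i} * 2 ^ b ≤
        2 ^ (a + c + d + 3) := by
  set Z : Finset ℕ := {z ∈ range (2 ^ B ^ 2) | ∀ i, a ≤ i → i < b → z.testBit i = f i} with hZ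
  have hrange : ∀ {X : Finset (List Bool)}, (∀ u ∈ X, u.length = B ^ 4) →
      X.image bitsToNat ⊆ range (2 ^ B ^ 4) := by
    intro X hX n hn
    obtain ⟨u, hu, rfl⟩ := mem_image.1 hn
    rw [mem_range, ← hX u hu]
    exact bitsToNat_lt u
  have hsplit : ∀ {c : ℕ}, 2 * B ^ 2 ≤ c → 2 ^ c = 2 ^ (2 * B ^ 2) * 2 ^ (c - 2 * B ^ 2) :=
    fun h => by rw [← pow_add, Nat.add_sub_cancel' h]
  have h1 := (isBalancedTable_blockTable hB).card_le_mul (hrange hX) (hrange hY)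
    (filter_subset _ _ : Z ⊆ _) (p := 2 ^ (c - 2 * B ^ 2)) (q := 2 ^ (d - 2 * B ^ 2))
    (by positivity) (by positivity) (by rw [← hsplit hc]; exact card_image_le.trans hXc)
    (by rw [← hsplit hd]; exact card_image_le.trans hYd)
  have h2 : #{p ∈ X ×ˢ Y | ∀ i, a ≤ i → i < b →
      (blockEntry B (bitsToNat p.1) (bitsToNat p.2)).testBit i = f i} ≤
      #{p ∈ X.image bitsToNat ×ˢ Y.image bitsToNat |
        tableEntry (2 ^ B ^ 4) (2 ^ B ^ 2) (blockTable B) p.1 p.2 ∈ Z} := by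
    refine card_le_card_of_injOn (fun p => (bitsToNat p.1, bitsToNat p.2)) ?_ ?_
    · rintro ⟨u, v⟩ h
      simp only [coe_filter, mem_product, Set.mem_ofPred_eq] at h
      simp only [coe_filter, mem_product, Set.mem_ofPred_eq, hZ, mem_filter, mem_range]
      exact ⟨⟨mem_image_of_mem _ h.1.1, mem_image_of_mem _ h.1.2⟩,
        Nat.mod_lt _ (by positivity), h.2⟩
    · rintro ⟨u, v⟩ h ⟨u', v'⟩ h' huv
      simp only [coe_filter, mem_product, Set.mem_ofPred_eq] at h h'
      simp only [Prod.mk.injEq] at huv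
      rw [bitsToNat_inj ((hX _ h.1.1).trans (hX _ h'.1.1).symm) huv.1,
        bitsToNat_inj ((hY _ h.1.2).trans (hY _ h'.1.2).symm) huv.2]
  have h3 := card_testBit_eq_le f (a := a) hb
  calc _ ≤ (2 ^ a * 2 ^ (B ^ 2 - b)) *
        (2 ^ (c - 2 * B ^ 2) * (2 ^ (d - 2 * B ^ 2) * (8 * 2 ^ (3 * B ^ 2)))) * 2 ^ b :=
        Nat.mul_le_mul_right _ (h2.trans (h1.trans (Nat.mul_le_mul_right _ h3)))
    _ = 2 ^ (a + c + d + 3) := by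
      rw [show (8 : ℕ) = 2 ^ 3 by norm_num]
      simp only [← pow_add]
      congr 1
      omega

end PairCounting

theorem blockBase_eq {j i : ℕ} (h₁ : 2 ^ 2 ^ j ≤ i) (h₂ : i < (2 ^ 2 ^ j) ^ 2) :
    blockBase i = 2 ^ 2 ^ j := by
  have h0 : i ≠ 0 := by
    have : 0 < 2 ^ 2 ^ j := by positivity
    omega
  have h3 : 2 ^ j ≤ Nat.log 2 i := Nat.le_log_of_pow_le (by norm_num) h₁
  have h4 : Nat.log 2 i < 2 ^ (j + 1) :=
    Nat.log_lt_of_lt_pow h0 (by rwa [pow_succ 2 j, pow_mul])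
  rw [blockBase, Nat.log_eq_of_pow_le_of_lt_pow h3 h4]

/-- The first `n` bits extracted from sequences with long initial segments `u` and `v`. -/
def extractPrefix (n : ℕ) (u v : List Bool) : List Bool :=
  (List.range n).map fun i =>
    extractBit i (bitsToNat (u.take (blockBase i ^ 4))) (bitsToNat (v.take (blockBase i ^ 4)))

theorem primrec_extractPrefix {α : Type*} [Primcodable α] {n : α → ℕ} {u v : α → List Bool}
    (hn : Primrec n) (hu : Primrec u) (hv : Primrec v) :
    Primrec fun a => extractPrefix (n a) (u a) (v a) := by
  have hb : Primrec fun q : α × ℕ => blockBase q.2 ^ 4 :=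
    primrec_pow.comp (primrec_blockBase.comp Primrec.snd) (Primrec.const 4)
  exact Primrec.list_map (Primrec.list_range.comp hn) (primrec_extractBit Primrec.snd
    (primrec_bitsToNat.comp (Primrec.list_take.comp hb (hu.comp Primrec.fst)))
    (primrec_bitsToNat.comp (Primrec.list_take.comp hb (hv.comp Primrec.fst))))

theorem initSeg_extractor (x y : BinSeq) {n t : ℕ} (h : ∀ i < n, blockBase i ^ 4 ≤ t) :
    initSeg (extractor x y) n = extractPrefix n (initSeg x t) (initSeg y t) := by
  rw [initSeg, extractPrefix]
  refine List.map_congr_left fun i hi => ?_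
  have hi' := h i (List.mem_range.1 hi)
  rw [extractor, take_initSeg x hi', take_initSeg y hi']

/-- `z` is the concatenation of two strings of length `b ^ 8` from which `w` is extracted, which
have initial segments of length `b ^ 4` and complexities at most `k₁'`, `k₂'`, and which occur among
the first `2 ^ m₁`, `2 ^ m₂` extensions of these segments with complexities at most `k₁`, `k₂`. -/
def IsDescribedPair (c : Code) (b k₁' k₂' n k₁ k₂ m₁ m₂ : ℕ) (w z : List Bool) (l : ℕ) : Prop :=
  z.length = 2 * b ^ 8 ∧
  OutputsWithin c k₁' ((z.take (b ^ 8)).take (b ^ 4)) l.unpair.1.unpair.1 ∧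
  OutputsWithin c k₂' ((z.drop (b ^ 8)).take (b ^ 4)) l.unpair.1.unpair.2 ∧
  z.take (b ^ 8) ∈ (enumList (extensionEnum c (b ^ 8, k₁, (z.take (b ^ 8)).take (b ^ 4)))
    l.unpair.2.unpair.1).take (2 ^ m₁) ∧
  z.drop (b ^ 8) ∈ (enumList (extensionEnum c (b ^ 8, k₂, (z.drop (b ^ 8)).take (b ^ 4)))
    l.unpair.2.unpair.2).take (2 ^ m₂) ∧
  extractPrefix n (z.take (b ^ 8)) (z.drop (b ^ 8)) = w

instance (c : Code) (b k₁' k₂' n k₁ k₂ m₁ m₂ : ℕ) (w z : List Bool) (l : ℕ) :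
    Decidable (IsDescribedPair c b k₁' k₂' n k₁ k₂ m₁ m₂ w z l) := by
  unfold IsDescribedPair; infer_instance

theorem primrecPred_isDescribedPair (c : Code) {α : Type*} [Primcodable α]
    {b k₁' k₂' n k₁ k₂ m₁ m₂ l : α → ℕ} {w z : α → List Bool} (hb : Primrec b)
    (hk₁' : Primrec k₁') (hk₂' : Primrec k₂') (hn : Primrec n) (hk₁ : Primrec k₁)
    (hk₂ : Primrec k₂) (hm₁ : Primrec m₁) (hm₂ : Primrec m₂) (hw : Primrec w) (hz : Primrec z)
    (hl : Primrec l) : PrimrecPred fun a => IsDescribedPair c (b a) (k₁' a) (k₂' a) (n a) (k₁ a)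
      (k₂ a) (m₁ a) (m₂ a) (w a) (z a) (l a) := by
  have h8 : Primrec fun a => b a ^ 8 := primrec_pow.comp hb (Primrec.const 8)
  have h4 : Primrec fun a => b a ^ 4 := primrec_pow.comp hb (Primrec.const 4)
  have hu : Primrec fun a => (z a).take (b a ^ 8) := Primrec.list_take.comp h8 hz
  have hv : Primrec fun a => (z a).drop (b a ^ 8) := Primrec.list_drop.comp h8 hz
  have hp : Primrec fun a => ((z a).take (b a ^ 8)).take (b a ^ 4) := Primrec.list_take.comp h4 hu
  have hq : Primrec fun a => ((z a).drop (b a ^ 8)).take (b a ^ 4) := Primrec.list_take.comp h4 hv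
  have hl' : Primrec fun a => (l a).unpair := Primrec.unpair.comp hl
  have hl1 := Primrec.unpair.comp (Primrec.fst.comp hl')
  have hl2 := Primrec.unpair.comp (Primrec.snd.comp hl')
  have htwo : ∀ {m : α → ℕ}, Primrec m → Primrec fun a => 2 ^ m a := fun hm =>
    primrec_pow.comp (Primrec.const 2) hm
  have hE := primrec_enumList (primrec_extensionEnum c)
  refine PrimrecPred.and (Primrec.eq.comp (Primrec.list_length.comp hz)
    (Primrec.nat_mul.comp (Primrec.const 2) h8)) <|
    PrimrecPred.and (primrecPred_outputsWithin c hk₁' hp (Primrec.fst.comp hl1)) <|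
    PrimrecPred.and (primrecPred_outputsWithin c hk₂' hq (Primrec.snd.comp hl1)) <|
    PrimrecPred.and (primrecPred_mem hu (Primrec.list_take.comp (htwo hm₁) (hE.comp
      (Primrec.pair h8 (Primrec.pair hk₁ hp)) (Primrec.fst.comp hl2)))) <|
    PrimrecPred.and (primrecPred_mem hv (Primrec.list_take.comp (htwo hm₂) (hE.comp
      (Primrec.pair h8 (Primrec.pair hk₂ hq)) (Primrec.snd.comp hl2)))) <|
    Primrec.eq.comp (primrec_extractPrefix hn hu hv) hw

namespace IsUniversalMachine

variable {U : List Bool →. List Bool} (hU : IsUniversalMachine U)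
include hU

theorem exists_finset_extensions {c : Code} (hc : IsCodeOf c U) (t k m : ℕ) (p : List Bool) :
    ∃ X : Finset (List Bool),
      (∀ u, u ∈ X ↔ ∃ l, u ∈ (enumList (extensionEnum c (t, k, p)) l).take (2 ^ m)) ∧
      (∀ u ∈ X, u.length = t) ∧ X.card ≤ 2 ^ m := by
  obtain ⟨X, hX, hXc⟩ := exists_finset_of_encard_le
    (encard_take_enumList_le (extensionEnum c (t, k, p)) (2 ^ m))
  refine ⟨X, hX, fun u hu => ?_, hXc⟩
  obtain ⟨l, hl⟩ := (hX u).1 hu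
  obtain ⟨i, -, hi⟩ := mem_enumList.1 (List.mem_of_mem_take hl)
  exact ((hU.exists_extensionEnum hc).1 ⟨i, hi⟩).1

-- G counts prefix pairs matching the digits in [b, b^2); S counts, over fixed prefixes, pairs of
-- listed extensions matching those in [b^2, n). The factor 2^(b^2) lost in S is gained in G. The 8
-- is 3 + 3 from the tables plus 1 + 1 from the bounds 2^(k+1).
open Finset in
theorem exists_finset_isDescribedPair {c : Code} (hc : IsCodeOf c U) {j b n : ℕ}
    (hb : b = 2 ^ 2 ^ j) (hbn : b ^ 2 ≤ n) (hnb : n ≤ b ^ 4) {k₁' k₂' k₁ k₂ m₁ m₂ : ℕ}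
    (hk₁' : 2 * b ^ 2 ≤ k₁' + 1) (hk₂' : 2 * b ^ 2 ≤ k₂' + 1) (hm₁ : 2 * b ^ 4 ≤ m₁)
    (hm₂ : 2 * b ^ 4 ≤ m₂) (w : List Bool) :
    ∃ F : Finset (List Bool), (∀ z l, IsDescribedPair c b k₁' k₂' n k₁ k₂ m₁ m₂ w z l → z ∈ F) ∧
      #F * 2 ^ n ≤ 2 ^ (b + k₁' + k₂' + m₁ + m₂ + 8) := by
  have hb2 : 2 ≤ b := hb ▸ (Nat.pow_le_pow_right (n := 2) (by simp) (Nat.one_le_two_pow (n := j)))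
  have hbb : b ≤ b ^ 2 := by nlinarith
  have hB2 : b ^ 2 = 2 ^ 2 ^ (j + 1) := by rw [hb, ← pow_mul, pow_succ 2 j]
  obtain ⟨P, hP, hPc⟩ := hU.exists_finset_plainK_le k₁'
  obtain ⟨Q, hQ, hQc⟩ := hU.exists_finset_plainK_le k₂'
  choose X hX hXl hXc using hU.exists_finset_extensions hc (b ^ 8) k₁ m₁
  choose Y hY hYl hYc using hU.exists_finset_extensions hc (b ^ 8) k₂ m₂
  let f : ℕ → Bool := fun i => w.getD i false
  let G : Finset (List Bool × List Bool) :=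
    {p ∈ {p ∈ P | p.length = b ^ 4} ×ˢ {q ∈ Q | q.length = b ^ 4} |
      ∀ i, b ≤ i → i < b ^ 2 → (blockEntry b (bitsToNat p.1) (bitsToNat p.2)).testBit i = f i}
  let S : List Bool × List Bool → Finset (List Bool × List Bool) := fun p =>
    {q ∈ X p.1 ×ˢ Y p.2 |
      ∀ i, b ^ 2 ≤ i → i < n →
        (blockEntry (b ^ 2) (bitsToNat q.1) (bitsToNat q.2)).testBit i = f i}
  have hG : #G * 2 ^ b ^ 2 ≤ 2 ^ (b + (k₁' + 1) + (k₂' + 1) + 3) :=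
    card_pairs_mul_two_pow_le hb2 (fun u hu => (mem_filter.1 hu).2) (fun u hu => (mem_filter.1 hu).2)
      hk₁' hk₂' ((card_filter_le _ _).trans hPc) ((card_filter_le _ _).trans hQc) le_rfl f
  have hS : ∀ p, #(S p) * 2 ^ n ≤ 2 ^ (b ^ 2 + m₁ + m₂ + 3) := fun p =>
    card_pairs_mul_two_pow_le (hb2.trans hbb)
      (fun u hu => (hXl _ u hu).trans (by ring)) (fun u hu => (hYl _ u hu).trans (by ring))
      (by rw [← pow_mul]; exact hm₁) (by rw [← pow_mul]; exact hm₂) (hXc _) (hYc _)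
      (by rw [← pow_mul]; exact hnb) f
  refine ⟨(G.biUnion S).image fun q => q.1 ++ q.2, fun z l hz => ?_, ?_⟩
  · obtain ⟨hzl, hp, hq, hu, hv, hw⟩ := hz
    have hlu : (z.take (b ^ 8)).length = b ^ 8 := by rw [List.length_take]; omega
    have hlv : (z.drop (b ^ 8)).length = b ^ 8 := by rw [List.length_drop]; omega
    have hb48 : b ^ 4 ≤ b ^ 8 := Nat.pow_le_pow_right (by omega) (by norm_num)
    have hf : ∀ i < n, f i = extractBit i (bitsToNat ((z.take (b ^ 8)).take (blockBase i ^ 4)))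
        (bitsToNat ((z.drop (b ^ 8)).take (blockBase i ^ 4))) := by
      intro i hi
      simp only [f, ← hw, extractPrefix]
      rw [List.getD_eq_getElem _ _ (by simpa using hi)]
      simp
    refine mem_image.2 ⟨(z.take (b ^ 8), z.drop (b ^ 8)), mem_biUnion.2
      ⟨((z.take (b ^ 8)).take (b ^ 4), (z.drop (b ^ 8)).take (b ^ 4)), ?_, ?_⟩,
      List.take_append_drop _ _⟩
    · refine mem_filter.2 ⟨mem_product.2 ⟨mem_filter.2 ⟨?_, ?_⟩, mem_filter.2 ⟨?_, ?_⟩⟩, ?_⟩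
      · exact (hP _).2 ((hU.exists_outputsWithin hc).1 ⟨_, hp⟩)
      · simp only [List.length_take, hlu]; omega
      · exact (hQ _).2 ((hU.exists_outputsWithin hc).1 ⟨_, hq⟩)
      · simp only [List.length_take, hlv]; omega
      · intro i hi hi'
        have hbase : blockBase i = b := by
          rw [hb]; exact blockBase_eq (hb ▸ hi) (hb ▸ hi')
        rw [hf i (by omega), extractBit, hbase]
    · refine mem_filter.2 ⟨mem_product.2 ⟨(hX _ _).2 ⟨_, hu⟩, (hY _ _).2 ⟨_, hv⟩⟩, ?_⟩
      intro i hi hi'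
      have hbase : blockBase i = b ^ 2 := by
        rw [hB2]
        refine blockBase_eq (hB2 ▸ hi) (lt_of_lt_of_le (hi'.trans_le hnb) (le_of_eq ?_))
        rw [← hB2]; ring
      have h8 : (b ^ 2) ^ 4 = b ^ 8 := by ring
      rw [hf i hi', extractBit, hbase, h8, List.take_of_length_le hlu.le,
        List.take_of_length_le hlv.le]
  · refine Nat.le_of_mul_le_mul_right (c := 2 ^ b ^ 2) ?_ (by positivity)
    calc _ ≤ (∑ p ∈ G, #(S p)) * 2 ^ n * 2 ^ b ^ 2 := by
          gcongr
          exact card_image_le.trans card_biUnion_le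
      _ = (∑ p ∈ G, #(S p) * 2 ^ n) * 2 ^ b ^ 2 := by rw [sum_mul]
      _ ≤ (#G * 2 ^ (b ^ 2 + m₁ + m₂ + 3)) * 2 ^ b ^ 2 := by
          gcongr
          exact sum_le_card_nsmul _ _ _ fun p _ => hS p
      _ = (#G * 2 ^ b ^ 2) * 2 ^ (b ^ 2 + m₁ + m₂ + 3) := by ring
      _ ≤ 2 ^ (b + (k₁' + 1) + (k₂' + 1) + 3) * 2 ^ (b ^ 2 + m₁ + m₂ + 3) := by gcongr
      _ = _ := by
          rw [← pow_add, ← pow_add]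
          congr 1
          ring

/-- A pair of strings is described by the string extracted from it and its position in an
enumeration of the pairs from which this string is extracted. -/
theorem exists_plainK_append_le {c : Code} (hc : IsCodeOf c U) :
    ∃ D, ∀ (j b n a m₁ m₂ : ℕ) (u v : List Bool), b = 2 ^ 2 ^ j → b ^ 2 ≤ n → n ≤ b ^ 4 →
      u.length = b ^ 8 → v.length = b ^ 8 →
      2 * b ^ 2 ≤ plainK U (u.take (b ^ 4)) + 1 → 2 * b ^ 2 ≤ plainK U (v.take (b ^ 4)) + 1 →
      2 * b ^ 4 ≤ m₁ → 2 * b ^ 4 ≤ m₂ →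
      (∃ l, u ∈ (enumList (extensionEnum c (b ^ 8, plainK U u, u.take (b ^ 4))) l).take (2 ^ m₁)) →
      (∃ l, v ∈ (enumList (extensionEnum c (b ^ 8, plainK U v, v.take (b ^ 4))) l).take (2 ^ m₂)) →
      b ^ 8 < 2 ^ a → plainK U u < 2 ^ a → plainK U v < 2 ^ a → plainK U (u.take (b ^ 4)) < 2 ^ a →
      plainK U (v.take (b ^ 4)) < 2 ^ a → m₁ < 2 ^ a → m₂ < 2 ^ a →
      plainK U (u ++ v) + n ≤ plainK U (extractPrefix n u v) + b + plainK U (u.take (b ^ 4)) +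
        plainK U (v.take (b ^ 4)) + m₁ + m₂ + 32 * a + D := by
  let R : ℕ × List Bool → List Bool → ℕ → Prop := fun q z l =>
    IsDescribedPair c q.1.unpair.1.unpair.1.unpair.1 q.1.unpair.1.unpair.1.unpair.2
      q.1.unpair.1.unpair.2.unpair.1 q.1.unpair.1.unpair.2.unpair.2
      q.1.unpair.2.unpair.1.unpair.1 q.1.unpair.2.unpair.1.unpair.2
      q.1.unpair.2.unpair.2.unpair.1 q.1.unpair.2.unpair.2.unpair.2 q.2 z l
  have hR : PrimrecPred fun q : ((ℕ × List Bool) × List Bool) × ℕ => R q.1.1 q.1.2 q.2 := by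
    have hq : Primrec fun q : ((ℕ × List Bool) × List Bool) × ℕ => q.1.1.1.unpair :=
      Primrec.unpair.comp (Primrec.fst.comp (Primrec.fst.comp Primrec.fst))
    have h1 := Primrec.unpair.comp (Primrec.fst.comp hq)
    have h2 := Primrec.unpair.comp (Primrec.snd.comp hq)
    have h11 := Primrec.unpair.comp (Primrec.fst.comp h1)
    have h12 := Primrec.unpair.comp (Primrec.snd.comp h1)
    have h21 := Primrec.unpair.comp (Primrec.fst.comp h2)
    have h22 := Primrec.unpair.comp (Primrec.snd.comp h2)
    exact primrecPred_isDescribedPair c (Primrec.fst.comp h11) (Primrec.snd.comp h11)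
      (Primrec.fst.comp h12) (Primrec.snd.comp h12) (Primrec.fst.comp h21) (Primrec.snd.comp h21)
      (Primrec.fst.comp h22) (Primrec.snd.comp h22)
      (Primrec.snd.comp (Primrec.fst.comp Primrec.fst)) (Primrec.snd.comp Primrec.fst) Primrec.snd
  have : ∀ q z, DecidablePred (R q z) := fun q z l => by
    simp only [R]; infer_instance
  obtain ⟨D, hD⟩ := hU.exists_plainK_le_of_enum (primrec_enumOfRel hR)
  refine ⟨D + 8, fun j b n a m₁ m₂ u v hb hbn hnb hu hv hk₁' hk₂' hm₁ hm₂ hlu hlv ha hk₁a hk₂a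
    hk₁'a hk₂'a hm₁a hm₂a => ?_⟩
  obtain ⟨lu, hlu⟩ := hlu
  obtain ⟨lv, hlv⟩ := hlv
  obtain ⟨lp, hlp⟩ := (hU.exists_outputsWithin hc (u := u.take (b ^ 4))).2 le_rfl
  obtain ⟨lq, hlq⟩ := (hU.exists_outputsWithin hc (u := v.take (b ^ 4))).2 le_rfl
  set k₁' := plainK U (u.take (b ^ 4))
  set k₂' := plainK U (v.take (b ^ 4))
  set k₁ := plainK U u
  set k₂ := plainK U v
  set w := extractPrefix n u v
  obtain ⟨F, hF, hFc⟩ := hU.exists_finset_isDescribedPair hc hb hbn hnb (k₁ := k₁) (k₂ := k₂)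
    hk₁' hk₂' hm₁ hm₂ w
  set E := b + k₁' + k₂' + m₁ + m₂ + 8 with hE
  have htake : (u ++ v).take (b ^ 8) = u := List.take_left' hu
  have hdrop : (u ++ v).drop (b ^ 8) = v := List.drop_left' hu
  have hdesc : IsDescribedPair c b k₁' k₂' n k₁ k₂ m₁ m₂ w (u ++ v)
      (Nat.pair (Nat.pair lp lq) (Nat.pair lu lv)) := by
    simp only [IsDescribedPair, Nat.unpair_pair, htake, hdrop]
    refine ⟨by rw [List.length_append]; omega, hlp, hlq, hlu, hlv, rfl⟩
  have hb0 : 0 < b := hb ▸ by positivity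
  have hb8 : b ≤ b ^ 8 := Nat.le_self_pow (by norm_num) b
  have hb48 : b ^ 4 ≤ b ^ 8 := Nat.pow_le_pow_right hb0 (by norm_num)
  -- The described pair itself makes F nonempty, so the subtraction E - n is not truncated.
  have hnE : n ≤ E := by
    have h1 : 1 ≤ F.card := Finset.card_pos.2 ⟨_, hF _ _ hdesc⟩
    exact (Nat.pow_le_pow_iff_right (by norm_num : 1 < 2)).1
      ((Nat.le_mul_of_pos_left _ h1).trans hFc)
  have hFs : F.card ≤ 2 ^ (E - n) := by
    refine Nat.le_of_mul_le_mul_right (c := 2 ^ n) ?_ (by positivity)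
    rwa [← pow_add, Nat.sub_add_cancel hnE]
  set code := Nat.pair (Nat.pair (Nat.pair b k₁') (Nat.pair k₂' n))
    (Nat.pair (Nat.pair k₁ k₂) (Nat.pair m₁ m₂)) with hcode
  have hcode_lt : code < 2 ^ (2 * (2 * (2 * a))) :=
    natPair_lt_two_pow
      (natPair_lt_two_pow (natPair_lt_two_pow (by omega) hk₁'a)
        (natPair_lt_two_pow hk₂'a (by omega)))
      (natPair_lt_two_pow (natPair_lt_two_pow hk₁a hk₂a) (natPair_lt_two_pow hm₁a hm₂a))
  have hR_iff : ∀ z l, R (code, w) z l ↔ IsDescribedPair c b k₁' k₂' n k₁ k₂ m₁ m₂ w z l := by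
    intro z l
    simp only [R, hcode, Nat.unpair_pair]
  have ha0 : 1 ≤ a := by
    by_contra h
    have : a = 0 := by omega
    subst this
    have : 0 < b ^ 8 := by positivity
    omega
  have hs : E - n < 2 ^ (2 * (2 * (2 * a))) := by
    have h1 : 2 ^ (2 * (2 * (2 * a))) = 2 ^ a * 2 ^ (7 * a) := by
      rw [← pow_add]; congr 1; ring
    have h2 : 2 ^ 7 ≤ 2 ^ (7 * a) := Nat.pow_le_pow_right (by simp) (by omega)
    have h3 : 2 ^ a * 2 ^ 7 ≤ 2 ^ a * 2 ^ (7 * a) := Nat.mul_le_mul_left _ h2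
    have h4 : 2 ^ 1 ≤ 2 ^ a := Nat.pow_le_pow_right (by simp) ha0
    omega
  -- Eight numbers paired three levels deep take 8a digits, whence 32a.
  have := hD code w (E - n) (2 * (2 * (2 * a))) (u ++ v) hcode_lt hs
    (exists_enumOfRel.2 ⟨_, (hR_iff _ _).2 hdesc⟩) (length_enumList_le (S := F)
      (by rw [Set.encard_coe_eq_coe_finsetCard]; exact_mod_cast hFs) fun k z hz => by
        obtain ⟨l, hl⟩ := exists_enumOfRel.1 ⟨k, hz⟩
        exact hF z l ((hR_iff _ _).1 hl))
  omega

end IsUniversalMachine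

/-! ### The rate of the extracted sequence -/

namespace IsUniversalMachine

variable {U : List Bool →. List Bool} (hU : IsUniversalMachine U)
include hU

/-- For a sequence of positive rate, the initial segment of length `b ^ 8` is listed early among the
extensions of the initial segment of length `b ^ 4`. -/
theorem exists_initSeg_extension {c : Code} (hc : IsCodeOf c U) {c₀ : ℕ}
    (hc₀ : ∀ w, plainK U w ≤ w.length + c₀) {τ : ℝ} (hτ : 0 < τ) {x : BinSeq}
    (hx : HasRandomnessRate U τ x) :
    ∃ D B₀, ∀ j b a : ℕ, b = 2 ^ 2 ^ j → B₀ ≤ b → a = 8 * 2 ^ j + c₀ + 4 → ∃ m, 2 * b ^ 4 ≤ m ∧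
      (∃ l, initSeg x (b ^ 8) ∈ (enumList (extensionEnum c
        (b ^ 8, plainK U (initSeg x (b ^ 8)), initSeg x (b ^ 4))) l).take (2 ^ m)) ∧
      m < 2 ^ a ∧ b ^ 8 < 2 ^ a ∧ plainK U (initSeg x (b ^ 8)) < 2 ^ a ∧
      plainK U (initSeg x (b ^ 4)) < 2 ^ a ∧ 2 * b ^ 2 ≤ plainK U (initSeg x (b ^ 4)) + 1 ∧
      plainK U (initSeg x (b ^ 4)) + m ≤ plainK U (initSeg x (b ^ 8)) + 16 * a + D := by
  obtain ⟨D, hD⟩ := hU.exists_mem_take_extensionEnum hc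
  obtain ⟨N, hN⟩ := Filter.eventually_atTop.1 hx
  -- From b ≥ T on, τb ≥ 3 + c₀; the rate then makes K(x(1:b^4)) ≥ 2b^2 and K(x(1:b^8)) ≥ 2b^4 +
  -- K(x(1:b^4)).
  obtain ⟨T, hT⟩ := exists_nat_ge ((3 + c₀) / τ)
  refine ⟨D, max N T, fun j b a hb hB ha => ?_⟩
  have hNb : N ≤ b := (le_max_left _ _).trans hB
  have hTb : 3 + (c₀ : ℝ) ≤ τ * b := by
    rw [← div_le_iff₀' hτ]
    exact hT.trans (by exact_mod_cast (le_max_right _ _).trans hB)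
  have hb1 : 1 ≤ b := hb ▸ Nat.one_le_two_pow
  have hb1' : (1 : ℝ) ≤ b := by exact_mod_cast hb1
  have hb4 : b ≤ b ^ 4 := Nat.le_self_pow (by norm_num) b
  have hb8 : b ^ 4 ≤ b ^ 8 := Nat.pow_le_pow_right hb1 (by norm_num)
  have hb24 : b ^ 2 ≤ b ^ 4 := Nat.pow_le_pow_right hb1 (by norm_num)
  have hr4 := hN (b ^ 4) (hNb.trans hb4)
  have hr8 := hN (b ^ 8) (hNb.trans (hb4.trans hb8))
  have hK4 := hc₀ (initSeg x (b ^ 4))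
  have hK8 := hc₀ (initSeg x (b ^ 8))
  rw [length_initSeg] at hK4 hK8
  have htake : (initSeg x (b ^ 8)).take (b ^ 4) = initSeg x (b ^ 4) := take_initSeg x hb8
  push_cast at hr4 hr8
  have h4 : 2 * b ^ 2 ≤ plainK U (initSeg x (b ^ 4)) := by
    have h1 : (2 : ℝ) * b ^ 2 ≤ τ * b ^ 4 := by
      have h2 : (2 : ℝ) ≤ τ * b := by
        have : (0 : ℝ) ≤ c₀ := by positivity
        linarith
      calc (2 : ℝ) * b ^ 2 ≤ (τ * b) * b ^ 2 := by gcongr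
        _ = τ * b ^ 3 := by ring
        _ ≤ τ * b ^ 4 := by gcongr; norm_num
    exact_mod_cast h1.trans hr4
  have h8 : 2 * b ^ 4 + plainK U (initSeg x (b ^ 4)) ≤ plainK U (initSeg x (b ^ 8)) := by
    have h1 : (3 + c₀ : ℝ) * b ^ 4 ≤ τ * b ^ 8 := by
      calc (3 + c₀ : ℝ) * b ^ 4 ≤ (τ * b) * b ^ 4 := by gcongr
        _ = τ * b ^ 5 := by ring
        _ ≤ τ * b ^ 8 := by gcongr; norm_num
    have h2 : (3 + c₀) * b ^ 4 ≤ plainK U (initSeg x (b ^ 8)) := by exact_mod_cast h1.trans hr8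
    have h3 : c₀ ≤ c₀ * b ^ 4 := Nat.le_mul_of_pos_right _ (by positivity)
    have h5 : (3 + c₀) * b ^ 4 = 3 * b ^ 4 + c₀ * b ^ 4 := by ring
    omega
  -- Since 2^(8·2^j) = b^8, a is O(log b). The spare bit in a - 1 absorbs m < 2^(a-1) + 1.
  have hpow : b ^ 8 + c₀ + 2 < 2 ^ (a - 1) := by
    have h1 : a - 1 = 2 ^ j * 8 + (c₀ + 3) := by omega
    rw [h1, pow_add, pow_mul, ← hb]
    have h2 : c₀ + 3 < 2 ^ (c₀ + 3) := Nat.lt_two_pow_self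
    have h3 : 1 ≤ b ^ 8 := Nat.one_le_pow _ _ hb1
    nlinarith
  have hpow2 : 2 ^ a = 2 * 2 ^ (a - 1) := by
    rw [← pow_succ', Nat.sub_add_cancel (by omega)]
  obtain ⟨m, ⟨l, hl⟩, hma, hm⟩ := hD (initSeg x (b ^ 8)) (b ^ 4) (a - 1)
    (by rw [length_initSeg]; exact hb8) (by rw [length_initSeg]; omega) (by omega)
  rw [length_initSeg, htake] at hl
  rw [htake] at hm
  -- Balance needs m ≥ 2b^4; raising m to that value keeps the final bound, by `h8`.
  refine ⟨max m (2 * b ^ 4), le_max_right _ _, ⟨l, ?_⟩, ?_, by omega, by omega, by omega, by omega,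
    ?_⟩
  · refine (List.take_prefix_take_left ?_).subset hl
    exact Nat.pow_le_pow_right (by simp) (le_max_left _ _)
  · refine max_lt ?_ ?_ <;> omega
  · rcases max_cases m (2 * b ^ 4) with ⟨h, -⟩ | ⟨h, -⟩ <;> rw [h] <;> omega

theorem exists_le_plainK_extractor {τ : ℝ} (hτ : 0 < τ) {x y : BinSeq}
    (hxy : HasDependency U (fun n => (n : ℝ) ^ (1 / 8 : ℝ)) x y) (hx : HasRandomnessRate U τ x)
    (hy : HasRandomnessRate U τ y) :
    ∃ (A : ℝ) (B₀ : ℕ), ∀ j b n : ℕ, b = 2 ^ 2 ^ j → B₀ ≤ b → b ^ 2 ≤ n → n ≤ b ^ 4 →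
      (n : ℝ) ≤ plainK U (initSeg (extractor x y) n) + A * b := by
  obtain ⟨c, hc⟩ := exists_isCodeOf hU.partrec
  obtain ⟨c₀, hc₀⟩ := hU.exists_plainK_le_length
  obtain ⟨C, hC⟩ := hxy
  obtain ⟨D₁, B₁, h₁⟩ := hU.exists_initSeg_extension hc hc₀ hτ hx
  obtain ⟨D₂, B₂, h₂⟩ := hU.exists_initSeg_extension hc hc₀ hτ hy
  obtain ⟨D, hD⟩ := hU.exists_plainK_append_le hc
  -- 2|C| comes from the dependency, 1 from the b bits given up, and 512 from (16 + 16 + 32)·8·2^j ≤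
  -- 512b; the rest is constant and is multiplied by b ≥ 1.
  refine ⟨2 * |C| + 1 + 512 + (64 * (c₀ + 4) + D₁ + D₂ + D), max B₁ B₂,
    fun j b n hb hB hbn hnb => ?_⟩
  obtain ⟨m₁, hm₁, hl₁, hma₁, hba, hka₁, hka₁', hk₁, hs₁⟩ :=
    h₁ j b _ hb ((le_max_left _ _).trans hB) rfl
  obtain ⟨m₂, hm₂, hl₂, hma₂, -, hka₂, hka₂', hk₂, hs₂⟩ :=
    h₂ j b _ hb ((le_max_right _ _).trans hB) rfl
  have hb1 : 1 ≤ b := hb ▸ Nat.one_le_two_pow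
  have hb8 : b ^ 4 ≤ b ^ 8 := Nat.pow_le_pow_right hb1 (by norm_num)
  have htx : (initSeg x (b ^ 8)).take (b ^ 4) = initSeg x (b ^ 4) := take_initSeg x hb8
  have hty : (initSeg y (b ^ 8)).take (b ^ 4) = initSeg y (b ^ 4) := take_initSeg y hb8
  have hjb : 2 ^ j ≤ b := hb ▸ Nat.lt_two_pow_self.le
  have hbase : ∀ i < n, blockBase i ^ 4 ≤ b ^ 8 := by
    intro i hi
    have hi' : i < b ^ 4 := hi.trans_le hnb
    have h1 : Nat.log 2 i < 2 ^ (j + 2) := by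
      rcases Nat.eq_zero_or_pos i with rfl | h0
      · simp
      · refine Nat.log_lt_of_lt_pow h0.ne' (hi'.trans_le (le_of_eq ?_))
        rw [hb, ← pow_mul, pow_add 2 j 2]; norm_num
    have h2 : Nat.log 2 (Nat.log 2 i) < j + 2 := by
      rcases Nat.eq_zero_or_pos (Nat.log 2 i) with h0 | h0
      · simp [h0]
      · exact Nat.log_lt_of_lt_pow h0.ne' h1
    have h3 : blockBase i ≤ b ^ 2 := by
      rw [hb, ← pow_mul, ← pow_succ, blockBase]
      exact Nat.pow_le_pow_right (by simp) (Nat.pow_le_pow_right (by simp) (by omega))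
    calc blockBase i ^ 4 ≤ (b ^ 2) ^ 4 := Nat.pow_le_pow_left h3 4
      _ = b ^ 8 := by ring
  have hmain := hD j b n (8 * 2 ^ j + c₀ + 4) m₁ m₂ (initSeg x (b ^ 8)) (initSeg y (b ^ 8)) hb hbn
    hnb (length_initSeg _ _) (length_initSeg _ _) (by rwa [htx]) (by rwa [hty]) hm₁ hm₂
    (by rwa [htx]) (by rwa [hty]) hba hka₁ hka₂ (by rwa [htx]) (by rwa [hty]) hma₁ hma₂
  rw [htx, hty, ← initSeg_extractor x y hbase] at hmain
  have hdep := hC (b ^ 8) (b ^ 8) (Nat.one_le_pow _ _ hb1) (Nat.one_le_pow _ _ hb1)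
  -- The reason for α = 1/8: at length b^8 the dependency costs O(b), like the bits given up.
  have hroot : ((b ^ 8 : ℕ) : ℝ) ^ (1 / 8 : ℝ) = b := by
    push_cast
    have := Real.pow_rpow_inv_natCast (x := (b : ℝ)) (n := 8) (by positivity) (by norm_num)
    rw [one_div]
    exact_mod_cast this
  simp only [hroot] at hdep
  have hsum : plainK U (initSeg x (b ^ 8) ++ initSeg y (b ^ 8)) + n ≤
      plainK U (initSeg (extractor x y) n) + b + plainK U (initSeg x (b ^ 8)) +
        plainK U (initSeg y (b ^ 8)) + 512 * b + (64 * (c₀ + 4) + D₁ + D₂ + D) := by omega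
  have hconst : 64 * (c₀ + 4) + D₁ + D₂ + D ≤ (64 * (c₀ + 4) + D₁ + D₂ + D) * b :=
    Nat.le_mul_of_pos_right _ hb1
  have hsum' : ((plainK U (initSeg x (b ^ 8) ++ initSeg y (b ^ 8)) + n : ℕ) : ℝ) ≤
      (plainK U (initSeg (extractor x y) n) + b + plainK U (initSeg x (b ^ 8)) +
        plainK U (initSeg y (b ^ 8)) + 512 * b + (64 * (c₀ + 4) + D₁ + D₂ + D) * b : ℕ) := by
    exact_mod_cast hsum.trans (Nat.add_le_add_left hconst _)
  push_cast at hsum'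
  have hCb : C * (b + b) ≤ |C| * (b + b) := by
    gcongr
    exact le_abs_self C
  linarith

theorem extractsRandomness_extractor {τ : ℝ} (hτ : 0 < τ) :
    ExtractsRandomness U τ (1 / 8) extractor := by
  intro x y hxy hx hy δ hδ
  obtain ⟨A, B₀, h⟩ := hU.exists_le_plainK_extractor hτ hxy hx hy
  obtain ⟨T, hT⟩ := exists_nat_ge (A / δ)
  set B := max B₀ T with hB
  refine Filter.eventually_atTop.2 ⟨max 4 (2 ^ 2 ^ (B + 1)), fun n hn => ?_⟩
  have hn4 : 4 ≤ n := (le_max_left _ _).trans hn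
  have hlog : 2 ≤ Nat.log 2 n := Nat.le_log_of_pow_le (by norm_num) hn4
  have hloglog : 1 ≤ Nat.log 2 (Nat.log 2 n) :=
    Nat.le_log_of_pow_le (by norm_num) (by simpa using hlog)
  -- b is taken one level below the block base of n, so that the block [b, b^2) is complete and n
  -- lies in the next one.
  obtain ⟨j, hj⟩ : ∃ j, Nat.log 2 (Nat.log 2 n) = j + 1 := ⟨_, (Nat.sub_add_cancel hloglog).symm⟩
  have hsq : (2 ^ 2 ^ j) ^ 2 = 2 ^ 2 ^ (j + 1) := by rw [← pow_mul, ← pow_succ]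
  have hlow : (2 ^ 2 ^ j) ^ 2 ≤ n := by
    rw [hsq, ← hj]
    exact (Nat.pow_le_pow_right (by simp) (Nat.pow_log_le_self 2 (by omega))).trans
      (Nat.pow_log_le_self 2 (by omega))
  have hhigh : n ≤ (2 ^ 2 ^ j) ^ 4 := by
    have h1 : (2 ^ 2 ^ j) ^ 4 = 2 ^ 2 ^ (j + 2) := by rw [← pow_mul, pow_add 2 j 2]; norm_num
    rw [h1]
    refine (Nat.lt_pow_succ_log_self (by norm_num : 1 < 2) n).le.trans
      (Nat.pow_le_pow_right (by simp) ?_)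
    have := Nat.lt_pow_succ_log_self (by norm_num : 1 < 2) (Nat.log 2 n)
    rw [hj] at this
    exact this
  have hBj : B ≤ j := by
    have h1 : 2 ^ (B + 1) ≤ Nat.log 2 n :=
      Nat.le_log_of_pow_le (by norm_num) ((le_max_right _ _).trans hn)
    have h2 : B + 1 ≤ Nat.log 2 (Nat.log 2 n) := Nat.le_log_of_pow_le (by norm_num) h1
    omega
  have hBb : B ≤ 2 ^ 2 ^ j :=
    hBj.trans (Nat.lt_two_pow_self.le.trans Nat.lt_two_pow_self.le)
  have hfin := h j _ n rfl ((le_max_left _ _).trans hBb) hlow hhigh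
  generalize 2 ^ 2 ^ j = b at hlow hBb hfin
  have hAb : A ≤ δ * b := by
    rw [← div_le_iff₀' hδ]
    exact hT.trans (by exact_mod_cast (le_max_right _ _).trans hBb)
  have hlow' : (b : ℝ) ^ 2 ≤ n := by exact_mod_cast hlow
  have h1 : A * b ≤ δ * n := by
    calc A * b ≤ (δ * b) * b := by gcongr
      _ = δ * b ^ 2 := by ring
      _ ≤ δ * n := by gcongr
  linarith

end IsUniversalMachine

theorem mainTheorem3 (U : List Bool →. List Bool) (hU : IsUniversalMachine U) :
    (∀ τ : ℝ, 0 < τ → ∃ α : ℝ, 0 < α ∧ α < 1 ∧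
      ∃ f : BinSeq → BinSeq → BinSeq,
        IsTruthTableReduction f ∧ ExtractsRandomness U τ α f) ∧
    (∃ F : ℚ → BinSeq → BinSeq → BinSeq, IsUniformTruthTableReduction F ∧
      ∀ τ : ℚ, 0 < τ → ∃ α : ℝ, 0 < α ∧ α < 1 ∧
        ExtractsRandomness U (τ : ℝ) α (F τ)) := by
  refine ⟨fun τ hτ => ⟨1 / 8, by norm_num, by norm_num, extractor, isTruthTableReduction_extractor,
    hU.extractsRandomness_extractor hτ⟩, fun _ => extractor,
    isUniformTruthTableReduction_const isTruthTableReduction_extractor, fun τ hτ =>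
    ⟨1 / 8, by norm_num, by norm_num, hU.extractsRandomness_extractor (by exact_mod_cast hτ)⟩⟩
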